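/- **Setting.** Let $m>0$, let $\lambda_P>0$, and let $\sigma=(\sigma^{\mu\nu})$ be a real antisymmetric $4\times4$ matrix with $\sigma_{\mu\nu}\sigma^{\mu\nu}=0$ and $(\tfrac12\sigma_{\mu\nu}\sigma_{\rho\tau}\epsilon^{\mu\nu\rho\tau})^2=16\lambda_P^8$, i.e. any point of the joint spectrum of the commutators $Q^{\mu\nu}=-i[q^\mu,q^\nu]$ of the quantum coordinates. Let $e^{i\alpha q}$, $\alpha\in\mathbb R^4$, be a strongly continuous family of unitaries on a Hilbert space $\mathcal H$ with $e^{i\alpha q}e^{i\beta q}=e^{i(\alpha+\beta)q}e^{-\frac i2\alpha\sigma\beta}$, where $k\sigma k'=k_\mu\sigma^{\mu\nu}k'_\nu$. Let $\varphi(x)=\int d\mu(k)\,(a(k)e^{-ikx}+a^*(k)e^{ikx})$ be the free scalar field of mass $m$ on the symmetric Fock space $\mathcal H_\varphi$, where $d\mu(k)=(2\pi)^{-3}\frac{d\mathbf k}{2\omega_{\mathbf k}}\big|_{k_0=\omega_{\mathbf k}}$, $\omega_{\mathbf k}=\sqrt{m^2+\mathbf k^2}$ and $[a(k),a^*(k')]=(2\pi)^3\,2\omega_{\mathbf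 k}\,\delta(\mathbf k-\mathbf k')$. Write $x_N=(x_i)_{i\in N}$ for a finite ordered set $N$, and $\check f(k_N)=(2\pi)^{-4|N|}\int dx_N\,f(x_N)e^{-ik_Nx_N}$ for $f\in\mathcal S(\mathbb R^{4|N|})$. The regularized products of fields $$\phi^{|N|}_f=\int dx_N\,\phi(q+x_1)\cdots\phi(q+x_{|N|})\,f(x_N),\qquad \phi(q+x)=\int d\mu(k)\,\big(a(k)\otimes e^{-ik(q+x)}+a^*(k)\otimes e^{ik(q+x)}\big),$$ are operators on the invariant domain in $\mathcal H_\varphi\otimes\mathcal H$ of finite sequences of symmetric, continuous, rapidly decreasing $\mathcal H$-valued momentum-space wave functions. A *contraction* $C$ in $N$ is a subset $A\subset N$ with an injective map $\alpha:A\to N\setminus A$ such that $\alpha(a)>a$; put $U=U_C=N\setminus(A\cup\alpha(A))$. Two arcs $(a,\alpha(a))$, $(a',\alpha(a'))$ with $a<a'<\alpha(a)<\alpha(a')$ are said to cross, and the connected components of $C$ are the classes of arcs generated by crossing; each is itself a contraction in $N$. A contraction is *quasiplanar* if there are no $u\in U$, $a\in A$ with $a<u<\alpha(a)$. Let $\mathcal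 C_{qp}(N)$ be the set of contractions in $N$ all of whose connected components are quasiplanar. The *quantum contraction* $\gamma^C:\mathcal S(\mathbb R^{4|N|})\to\mathcal S(\mathbb R^{4|U|})$ is given by $$(\gamma^Cf)\check{\ }(k_U)=(2\pi)^{8|A|}\int\prod_{a\in A}d\mu(k_a)\;e^{-i\sum_{a<a'<\alpha(a)<\alpha(a')}k_a\sigma k_{a'}\,-\,i\sum_{a<u<\alpha(a)}k_a\sigma k_u}\;\check f(k_N)\big|_{k_{\alpha(A)}=-k_A},$$ with $a,a'\in A$ and $u\in U$ in the sums. The *quasiplanar Wick product* is $$:\!\phi^{|N|}_f\!:_{qp}\;=\sum_{C\in\mathcal C_{qp}(N)}(-1)^{\kappa_C}\,\phi^{|U_C|}_{\gamma^C(f)},$$ where $\kappa_C$ is the number of connected components of $C$. **Theorem.** Let $N$ and $M$ be finite ordered sets with $n$ and $m'$ elements, for example $N=\{1,\dots,n\}$ and $M=\{n+1,\dots,n+m'\}$, and let $N\sqcup M$ be ordered such that every element of $N$ precedes every element of $M$. Let $\mathcal C(N,M)$ be the set of quasiplanar contractions in $N\sqcup M$ each of whose connected components contains an arc $(a,\alpha(a))$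 with $a\in N$ and $\alpha(a)\in M$. Then, for all $f\in\mathcal S(\mathbb R^{4n})$ and $g\in\mathcal S(\mathbb R^{4m'})$, $$:\!\phi^n_f\!:_{qp}\;:\!\phi^{m'}_g\!:_{qp}\;=\sum_{C\in\mathcal C(N,M)}:\!\phi^{|U_C|}_{\gamma^C(f\otimes g)}\!:_{qp}.$$ -/

import Mathlib

namespace QPWick

open MeasureTheory SchwartzMap Real
open scoped ContDiff FourierTransform RealInnerProductSpace

/-! ### Auxiliary facts on Schwartz functions -/

lemma hasTemperateGrowth_expI : (fun t : ℝ => Complex.exp (t * Complex.I)).HasTemperateGrowth := by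
  refine ⟨(Complex.ofRealCLM.contDiff.mul contDiff_const).cexp, fun n => ⟨0, 1, fun t => ?_⟩⟩
  have h : ∀ n : ℕ, iteratedDeriv n (fun t : ℝ => Complex.exp (t * Complex.I)) =
      fun t : ℝ => Complex.I ^ n * Complex.exp (t * Complex.I) := by
    intro n
    induction n with
    | zero => simp
    | succ n ih =>
      rw [iteratedDeriv_succ, ih]
      ext t
      have h1 : HasDerivAt (fun t : ℝ => (t : ℂ) * Complex.I) Complex.I t := by
        simpa using (Complex.ofRealCLM.hasDerivAt (x := t)).mul_const Complex.I
      rw [((h1.cexp).const_mul _).deriv]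
      ring
  rw [norm_iteratedFDeriv_eq_norm_iteratedDeriv, h]
  simp [Complex.norm_exp]

lemma schwartz_partial_bound {P K V : Type} [NormedAddCommGroup P] [NormedSpace ℝ P]
    [NormedAddCommGroup K] [NormedSpace ℝ K] [NormedAddCommGroup V] [NormedSpace ℝ V]
    (H : 𝓢(P × K, V)) (a b : ℕ) :
    ∃ C : ℝ, 0 ≤ C ∧ ∀ p k, ‖k‖ ^ b * ‖H (p, k)‖ ≤ C * (1 + ‖p‖) ^ (-(a : ℝ)) := by
  refine ⟨2 ^ (a + b) * ((Finset.Iic (a + b, 0)).sup fun m => SchwartzMap.seminorm ℝ m.1 m.2) H,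
    by positivity, fun p k => ?_⟩
  have h := SchwartzMap.one_add_le_sup_seminorm_apply (𝕜 := ℝ) (m := (a + b, 0)) (k := a + b)
    (n := 0) le_rfl le_rfl H (p, k)
  rw [norm_iteratedFDeriv_zero] at h
  rw [Real.rpow_neg (by positivity), Real.rpow_natCast, ← div_eq_mul_inv,
    le_div_iff₀ (by positivity)]
  refine le_trans ?_ h
  have hp : ‖p‖ ≤ ‖(p, k)‖ := norm_fst_le (p, k)
  have hk : ‖k‖ ≤ 1 + ‖(p, k)‖ := (norm_snd_le (p, k)).trans (by simp)
  calc ‖k‖ ^ b * ‖H (p, k)‖ * (1 + ‖p‖) ^ a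
      ≤ (1 + ‖(p, k)‖) ^ b * ‖H (p, k)‖ * (1 + ‖(p, k)‖) ^ a := by gcongr
    _ = _ := by rw [pow_add]; ring

lemma schwartz_partial_integral {P K : Type} [NormedAddCommGroup P] [NormedSpace ℝ P]
    [NormedAddCommGroup K] [NormedSpace ℝ K] [MeasurableSpace P] [BorelSpace P]
    [SecondCountableTopology P]
    (ν : Measure P) [ν.HasTemperateGrowth] (n : ℕ) : ∀ {V : Type} [NormedAddCommGroup V]
    [NormedSpace ℝ V] (H : 𝓢(P × K, V)),
    ContDiff ℝ n (fun k => ∫ p, H (p, k) ∂ν) ∧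
    ∀ b : ℕ, ∃ C : ℝ, ∀ k, ‖k‖ ^ b * ‖iteratedFDeriv ℝ n (fun k => ∫ p, H (p, k) ∂ν) k‖ ≤ C := by
  have hint := Measure.integrable_pow_neg_integrablePower ν
  have hcont : ∀ {V : Type} [NormedAddCommGroup V] [NormedSpace ℝ V] (H : 𝓢(P × K, V)) (k : K),
      Continuous fun p => H (p, k) := fun H k => H.continuous.comp (by fun_prop)
  have hI : ∀ {V : Type} [NormedAddCommGroup V] [NormedSpace ℝ V] (H : 𝓢(P × K, V)) (k : K),
      Integrable (fun p => H (p, k)) ν := by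
    intro V _ _ H k
    obtain ⟨C, hC, h⟩ := schwartz_partial_bound H ν.integrablePower 0
    exact (hint.const_mul C).mono' (hcont H k).aestronglyMeasurable
      (.of_forall fun p => by simpa using h p k)
  induction n with
  | zero =>
    intro V _ _ H
    refine ⟨?_, fun b => ?_⟩
    · obtain ⟨C, hC, h⟩ := schwartz_partial_bound H ν.integrablePower 0
      rw [Nat.cast_zero, contDiff_zero]
      exact continuous_of_dominated (fun k => (hcont H k).aestronglyMeasurable)
        (fun k => .of_forall fun p => by simpa using h p k) (hint.const_mul C)
        (.of_forall fun p => H.continuous.comp (by fun_prop))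
    · obtain ⟨C, hC, h⟩ := schwartz_partial_bound H ν.integrablePower b
      refine ⟨∫ p, C * (1 + ‖p‖) ^ (-(ν.integrablePower : ℝ)) ∂ν, fun k => ?_⟩
      rw [norm_iteratedFDeriv_zero]
      calc ‖k‖ ^ b * ‖∫ p, H (p, k) ∂ν‖ ≤ ‖k‖ ^ b * ∫ p, ‖H (p, k)‖ ∂ν := by
            gcongr; exact norm_integral_le_integral_norm _
        _ = ∫ p, ‖k‖ ^ b * ‖H (p, k)‖ ∂ν := by rw [integral_const_mul]
        _ ≤ _ := integral_mono ((hI H k).norm.const_mul _) (hint.const_mul C) fun p => h p k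
  | succ n ih =>
    intro V _ _ H
    let L : ((P × K) →L[ℝ] V) →L[ℝ] (K →L[ℝ] V) :=
      (ContinuousLinearMap.compL ℝ K (P × K) V).flip (ContinuousLinearMap.inr ℝ P K)
    let H' : 𝓢(P × K, K →L[ℝ] V) := SchwartzMap.postcompCLM L (SchwartzMap.fderivCLM ℝ _ _ H)
    have hder : ∀ p k, HasFDerivAt (fun k => H (p, k)) (H' (p, k)) k := by
      intro p k
      have h1 : HasFDerivAt (fun k : K => (p, k)) (ContinuousLinearMap.inr ℝ P K) k :=
        hasFDerivAt_prodMk_right p k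
      exact (H.hasFDerivAt (p, k)).comp k h1
    have hd : ∀ k, HasFDerivAt (fun k => ∫ p, H (p, k) ∂ν) (∫ p, H' (p, k) ∂ν) k := by
      intro k
      obtain ⟨C, hC, h⟩ := schwartz_partial_bound H' ν.integrablePower 0
      exact hasFDerivAt_integral_of_dominated_of_fderiv_le (s := Set.univ) (F := fun k p => H (p, k))
        (F' := fun k p => H' (p, k)) Filter.univ_mem
        (.of_forall fun k => (hcont H k).aestronglyMeasurable) (hI H k)
        (hcont H' k).aestronglyMeasurable
        (.of_forall fun p k _ => by simpa using h p k) (hint.const_mul C)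
        (.of_forall fun p k _ => hder p k)
    have hf : fderiv ℝ (fun k => ∫ p, H (p, k) ∂ν) = fun k => ∫ p, H' (p, k) ∂ν :=
      funext fun k => (hd k).fderiv
    refine ⟨?_, fun b => ?_⟩
    · rw [show ((n + 1 : ℕ) : WithTop ℕ∞) = (n : WithTop ℕ∞) + 1 by norm_cast,
        contDiff_succ_iff_fderiv]
      exact ⟨fun k => (hd k).differentiableAt, by simp, by rw [hf]; exact (ih H').1⟩
    · obtain ⟨C, hC⟩ := (ih H').2 b
      exact ⟨C, fun k => by rw [← norm_iteratedFDeriv_fderiv, hf]; exact hC k⟩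

/-! ### Momenta, the mass shell, and the noncommutativity matrices -/

/-- Momenta `k = (k_0, k_1, k_2, k_3)`, given by their covariant components, so that the
pairing with a point `x = (x^0, x^1, x^2, x^3)` is `kx = ∑ k_μ x^μ`. -/
abbrev Mom := Fin 4 → ℝ

/-- Spatial momenta. -/
abbrev Mom3 := EuclideanSpace ℝ (Fin 3)

/-- `ω_𝐩 = √(m² + 𝐩²)`. -/
noncomputable def energy (m : ℝ) (p : Mom3) : ℝ := √(m ^ 2 + ‖p‖ ^ 2)

/-- The point `(ω_𝐩, 𝐩)` of the positive mass shell. -/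
noncomputable def onShell (m : ℝ) (p : Mom3) : Mom := Matrix.vecCons (energy m p) fun i => p i

/-- The Lorentz-invariant measure `dμ(k) = (2π)⁻³ d𝐤 / (2 ω_𝐤)` on the mass shell, which is
parametrized by the spatial momentum. -/
noncomputable def massShell (m : ℝ) : Measure Mom3 :=
  volume.withDensity fun p => ENNReal.ofReal ((2 * π) ^ (-3 : ℤ) / (2 * energy m p))

/-- `k σ k' = ∑ k_μ σ^{μν} k'_ν`. -/
noncomputable def twist (σ : Matrix (Fin 4) (Fin 4) ℝ) (k k' : Mom) : ℝ :=
  ∑ μ, ∑ ν, k μ * σ μ ν * k' ν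

/-- The diagonal of the Minkowski metric. -/
def minkowski : Fin 4 → ℝ := ![1, -1, -1, -1]

/-- The joint spectrum `Σ` of the commutators `Q^{μν}` of the quantum coordinates, for the Planck
length `ℓ`: the antisymmetric matrices `σ^{μν}` with `σ_{μν} σ^{μν} = 0` and
`(½ σ_{μν} σ_{ρτ} ε^{μνρτ})² = 16 ℓ⁸`. -/
def quantumSpectrum (ℓ : ℝ) : Set (Matrix (Fin 4) (Fin 4) ℝ) :=
  {σ | (∀ μ ν, σ ν μ = -σ μ ν) ∧
    ∑ μ, ∑ ν, (minkowski μ * minkowski ν * σ μ ν) * σ μ ν = 0 ∧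
    ((1 / 2) * ∑ τ : Equiv.Perm (Fin 4), ((Equiv.Perm.sign τ : ℤ) : ℝ) *
      (minkowski (τ 0) * minkowski (τ 1) * σ (τ 0) (τ 1)) *
      (minkowski (τ 2) * minkowski (τ 3) * σ (τ 2) (τ 3))) ^ 2 = 16 * ℓ ^ 8}

lemma le_energy (m : ℝ) (p : Mom3) : m ≤ energy m p :=
  Real.le_sqrt_of_sq_le (by nlinarith [sq_nonneg ‖p‖])

lemma norm_le_energy (m : ℝ) (p : Mom3) : ‖p‖ ≤ energy m p :=
  Real.le_sqrt_of_sq_le (by nlinarith [sq_nonneg m])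

lemma norm_le_onShell (m : ℝ) (p : Mom3) : ‖p‖ ≤ ‖onShell m p‖ :=
  (norm_le_energy m p).trans ((le_abs_self _).trans (norm_le_pi_norm (onShell m p) 0))

lemma continuous_onShell (m : ℝ) : Continuous (onShell m) := by
  refine continuous_pi fun i => ?_
  refine Fin.cases ?_ (fun j => ?_) i
  · simp only [onShell, Matrix.cons_val_zero, energy]; fun_prop
  · simp only [onShell, Matrix.cons_val_succ]; fun_prop

instance (m : ℝ) : SigmaFinite (massShell m) := by
  unfold massShell; infer_instance

lemma massShell_temperate {m : ℝ} (hm : 0 < m) : (massShell m).HasTemperateGrowth := by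
  obtain ⟨n, hn⟩ := (inferInstance : (volume : Measure Mom3).HasTemperateGrowth).exists_integrable
  refine ⟨n, ?_⟩
  have hle : massShell m ≤ ENNReal.ofReal ((2 * π) ^ (-3 : ℤ) / (2 * m)) • volume := by
    rw [← withDensity_const]
    refine withDensity_mono (.of_forall fun p => ENNReal.ofReal_le_ofReal ?_)
    have := le_energy m p
    gcongr
  exact (hn.smul_measure ENNReal.ofReal_ne_top).mono_measure hle

lemma pi_massShell_temperate {m : ℝ} (hm : 0 < m) (ι : Type) [Fintype ι] :
    (Measure.pi fun _ : ι => massShell m).HasTemperateGrowth := by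
  obtain ⟨n, hn⟩ := (massShell_temperate hm).exists_integrable
  refine ⟨n * Fintype.card ι, ?_⟩
  have h := Integrable.fintype_prod (μ := fun _ : ι => massShell m)
    (f := fun _ p => (1 + ‖p‖) ^ (-(n : ℝ))) (fun _ => hn)
  refine h.mono' (Continuous.aestronglyMeasurable ?_) (.of_forall fun x => ?_)
  · exact Continuous.rpow_const (by fun_prop) fun x => Or.inl (by positivity)
  · rw [Real.norm_of_nonneg (by positivity), Real.rpow_neg (by positivity), Real.rpow_natCast]
    simp_rw [Real.rpow_neg (add_nonneg zero_le_one (norm_nonneg _)), Real.rpow_natCast]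
    rw [Finset.prod_inv_distrib]
    refine inv_anti₀ (Finset.prod_pos fun i _ => by positivity) ?_
    rw [pow_mul, ← Finset.card_univ, ← Finset.prod_const]
    refine Finset.prod_le_prod (fun i _ => by positivity) fun i _ => ?_
    gcongr
    exact norm_le_pi_norm x i

/-! ### Test functions -/

/-- Tuples `(x_i)_{i ∈ N}` of points (or momenta) in `ℝ⁴`; this is `ℝ^{4|N|}`, the tuple being
ordered by the order of `N`. -/
abbrev Config (N : Finset ℕ) := EuclideanSpace ℝ (N × Fin 4)

/-- The entry with label `i`. -/
def Config.at {N : Finset ℕ} (k : Config N) (i : N) : Mom := fun μ => k (i, μ)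

/-- The projection `x ↦ (x_i)_{i ∈ N}`. -/
noncomputable def restrictConfig {N M : Finset ℕ} (h : N ⊆ M) : Config M →L[ℝ] Config N :=
  LinearMap.toContinuousLinearMap
    { toFun := fun x => WithLp.toLp 2 fun i => x (⟨i.1.1, h i.1.2⟩, i.2)
      map_add' := fun _ _ => rfl
      map_smul' := fun _ _ => rfl }

/-- Multiplication by a nonzero number. -/
noncomputable def scaleEquiv (N : Finset ℕ) (c : ℝ) (hc : c ≠ 0) : Config N ≃L[ℝ] Config N :=
  ContinuousLinearEquiv.smulLeft (Units.mk0 c hc)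

lemma scaleEquiv_apply (N : Finset ℕ) (c : ℝ) (hc : c ≠ 0) (x : Config N) :
    scaleEquiv N c hc x = c • x := rfl

/-- The transform `f̌(k) = (2π)^{-4|N|} ∫ dx f(x) e^{-ikx}`, see `fourierCheck_apply`. -/
noncomputable def fourierCheck {N : Finset ℕ} (f : 𝓢(Config N, ℂ)) : 𝓢(Config N, ℂ) :=
  ((2 * π : ℂ) ^ (4 * N.card))⁻¹ • SchwartzMap.compCLMOfContinuousLinearEquiv ℂ
    (scaleEquiv N (2 * π)⁻¹ (by positivity)) (𝓕 f)

/-- The inverse of `f ↦ f̌`, that is `F ↦ ∫ dk F(k) e^{ikx}`. -/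
noncomputable def fourierSynth {N : Finset ℕ} (F : 𝓢(Config N, ℂ)) : 𝓢(Config N, ℂ) :=
  (2 * π : ℂ) ^ (4 * N.card) • 𝓕⁻ (SchwartzMap.compCLMOfContinuousLinearEquiv ℂ
    (scaleEquiv N (2 * π) (by positivity)) F)

lemma fourierCheck_apply {N : Finset ℕ} (f : 𝓢(Config N, ℂ)) (k : Config N) :
    fourierCheck f k = ((2 * π : ℂ) ^ (4 * N.card))⁻¹ *
      ∫ x : Config N, f x * Complex.exp (-Complex.I * (⟪k, x⟫ : ℝ)) := by
  have : fourierCheck f k = ((2 * π : ℂ) ^ (4 * N.card))⁻¹ * 𝓕 (f : Config N → ℂ) ((2 * π)⁻¹ • k) := rfl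
  rw [this, Real.fourier_eq']
  congr 2
  ext x
  rw [smul_eq_mul, mul_comm]
  congr 2
  rw [real_inner_smul_right, real_inner_comm]
  have : π ≠ 0 := Real.pi_ne_zero
  rw [show -2 * π * ((2 * π)⁻¹ * ⟪k, x⟫) = -⟪k, x⟫ by field_simp]
  push_cast
  ring

lemma fourierCheck_fourierSynth {N : Finset ℕ} (F : 𝓢(Config N, ℂ)) :
    fourierCheck (fourierSynth F) = F := by
  ext k
  have h : (2 * π : ℂ) ^ (4 * N.card) ≠ 0 := by
    have := Real.pi_ne_zero
    simp [this]
  simp only [fourierCheck, fourierSynth, FourierTransform.fourier_smul, FourierTransform.fourier_fourierInv_eq]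
  rw [map_smul, smul_apply, smul_apply, inv_smul_smul₀ h]
  simp only [SchwartzMap.compCLMOfContinuousLinearEquiv_apply, Function.comp_apply,
    scaleEquiv_apply]
  rw [smul_inv_smul₀ (by positivity)]

lemma Config.norm_le_sum {N : Finset ℕ} (x : Config N) : ‖x‖ ≤ ∑ j, |x j| := by
  rw [EuclideanSpace.norm_eq]
  refine Real.sqrt_le_iff.2 ⟨by positivity, ?_⟩
  simpa using Finset.sum_sq_le_sq_sum_of_nonneg (s := Finset.univ) (f := fun j => |x j|)
    (fun _ _ => abs_nonneg _)

/-! ### Contractions -/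

/-- A contraction in `N`: a subset `A ⊆ N` with an injective map `α : A → N \ A` such that
`α a > a`, given by its graph, the set of the pairs `(a, α a)`. -/
@[ext] structure Contraction (N : Finset ℕ) where
  arcs : Finset (ℕ × ℕ)
  mem_and_lt : ∀ c ∈ arcs, c.1 ∈ N ∧ c.2 ∈ N ∧ c.1 < c.2
  disjoint : ∀ c ∈ arcs, ∀ d ∈ arcs, c ≠ d → c.1 ≠ d.1 ∧ c.2 ≠ d.2 ∧ c.1 ≠ d.2

noncomputable instance (N : Finset ℕ) : Fintype (Contraction N) :=
  Fintype.ofInjective (β := (N ×ˢ N).powerset)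
    (fun C => ⟨C.arcs, Finset.mem_powerset.2 fun c hc =>
      Finset.mem_product.2 ⟨(C.mem_and_lt c hc).1, (C.mem_and_lt c hc).2.1⟩⟩)
    fun C D h => Contraction.ext (congrArg Subtype.val h)

/-- The labels that are contracted by a set of arcs, `A ∪ α(A)`. -/
def endpoints (K : Finset (ℕ × ℕ)) : Finset ℕ := K.image Prod.fst ∪ K.image Prod.snd

/-- The set `U` of uncontracted labels. -/
def Contraction.uncontracted {N : Finset ℕ} (C : Contraction N) : Finset ℕ :=
  N \ endpoints C.arcs

/-- `a < a' < α a < α a'` for `c = (a, α a)` and `d = (a', α a')`. -/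
def Crosses (c d : ℕ × ℕ) : Prop := c.1 < d.1 ∧ d.1 < c.2 ∧ c.2 < d.2

instance (c d : ℕ × ℕ) : Decidable (Crosses c d) :=
  inferInstanceAs (Decidable (c.1 < d.1 ∧ d.1 < c.2 ∧ c.2 < d.2))

/-- `a < u < α a` for `c = (a, α a)`. -/
def Encloses (c : ℕ × ℕ) (u : ℕ) : Prop := c.1 < u ∧ u < c.2

instance (c : ℕ × ℕ) (u : ℕ) : Decidable (Encloses c u) :=
  inferInstanceAs (Decidable (c.1 < u ∧ u < c.2))

open Classical in
/-- The connected component of `c` in the set of arcs `K`, where arcs that cross are connected. -/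
noncomputable def component (K : Finset (ℕ × ℕ)) (c : ℕ × ℕ) : Finset (ℕ × ℕ) :=
  K.filter fun d => Relation.EqvGen (fun x y => x ∈ K ∧ y ∈ K ∧ Crosses x y) c d

open Classical in
/-- The connected components of a set of arcs. -/
noncomputable def components (K : Finset (ℕ × ℕ)) : Finset (Finset (ℕ × ℕ)) :=
  K.image (component K)

/-- The set of arcs `K`, as a contraction in `N`, has vanishing enclosure matrix: no label of `N`
that `K` leaves uncontracted lies below an arc of `K`. -/
def Quasiplanar (N : Finset ℕ) (K : Finset (ℕ × ℕ)) : Prop :=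
  ∀ c ∈ K, ∀ u ∈ N \ endpoints K, ¬ Encloses c u

open Classical in
/-- The contractions in `N` all of whose connected components are quasiplanar (as contractions
in `N`). -/
noncomputable def qpContractions (N : Finset ℕ) : Finset (Contraction N) :=
  Finset.univ.filter fun C => ∀ K ∈ components C.arcs, Quasiplanar N K

open Classical in
/-- The quasiplanar contractions in `N ⊔ M` each of whose connected components contains an arc
from `N` to `M`. -/
noncomputable def connectingContractions (N M : Finset ℕ) : Finset (Contraction (N ∪ M)) :=
  Finset.univ.filter fun C => Quasiplanar (N ∪ M) C.arcs ∧
    ∀ K ∈ components C.arcs, ∃ c ∈ K, c.1 ∈ N ∧ c.2 ∈ M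

/-! ### The quantum contraction maps -/

section Gamma

variable {N : Finset ℕ} (C : Contraction N)

/-- The momenta `k_N` with `k_a` on the mass shell for `a ∈ A`, `k_{α(a)} = -k_a`, and the given
`k_U`; see `momenta_fst`, `momenta_snd` and `momenta_uncontracted`. -/
noncomputable def Contraction.momenta (m : ℝ) (p : C.arcs → Mom3) (k : Config C.uncontracted) :
    Config N :=
  WithLp.toLp 2 fun j =>
    (∑ c : C.arcs, ((if c.1.1 = j.1 then 1 else 0) - (if c.1.2 = j.1 then 1 else 0)) *
      onShell m (p c) j.2) +
    if h : j.1.1 ∈ C.uncontracted then k (⟨j.1.1, h⟩, j.2) else 0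

/-- `⟨k_A, I k_A⟩ + ⟨k_A, E k_U⟩` with the intersection matrix `I` and the enclosure matrix `E`. -/
noncomputable def Contraction.phase (m : ℝ) (σ : Matrix (Fin 4) (Fin 4) ℝ) (p : C.arcs → Mom3)
    (k : Config C.uncontracted) : ℝ :=
  (∑ c : C.arcs, ∑ d : C.arcs,
    if Crosses c d then twist σ (onShell m (p c)) (onShell m (p d)) else 0) +
  ∑ c : C.arcs, ∑ u : C.uncontracted,
    if Encloses c u then twist σ (onShell m (p c)) (k.at u) else 0

lemma Contraction.momenta_fst (m : ℝ) (p : C.arcs → Mom3) (k : Config C.uncontracted)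
    (c : C.arcs) (i : N) (hi : c.1.1 = i) (μ : Fin 4) :
    C.momenta m p k (i, μ) = onShell m (p c) μ := by
  have hu : i.1 ∉ C.uncontracted := fun h => (Finset.mem_sdiff.1 h).2
    (Finset.mem_union_left _ (Finset.mem_image.2 ⟨c.1, c.2, hi⟩))
  simp only [momenta, hu, dite_false, add_zero]
  rw [Finset.sum_eq_single c]
  · have := (C.mem_and_lt c c.2).2.2
    rw [if_pos hi, if_neg (by omega)]; ring
  · intro d _ hd
    have h := C.disjoint c c.2 d d.2 fun h => hd (Subtype.ext h.symm)
    rw [if_neg (by omega), if_neg (by omega)]; ring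
  · simp

lemma Contraction.momenta_snd (m : ℝ) (p : C.arcs → Mom3) (k : Config C.uncontracted)
    (c : C.arcs) (i : N) (hi : c.1.2 = i) (μ : Fin 4) :
    C.momenta m p k (i, μ) = -onShell m (p c) μ := by
  have hu : i.1 ∉ C.uncontracted := fun h => (Finset.mem_sdiff.1 h).2
    (Finset.mem_union_right _ (Finset.mem_image.2 ⟨c.1, c.2, hi⟩))
  simp only [momenta, hu, dite_false, add_zero]
  rw [Finset.sum_eq_single c]
  · have := (C.mem_and_lt c c.2).2.2
    rw [if_pos hi, if_neg (by omega)]; ring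
  · intro d _ hd
    have hne : d.1 ≠ c.1 := fun h => hd (Subtype.ext h)
    have h := C.disjoint c c.2 d d.2 hne.symm
    have h' := C.disjoint d d.2 c c.2 hne
    rw [if_neg (by omega), if_neg (by omega)]; ring
  · simp

lemma Contraction.momenta_uncontracted (m : ℝ) (p : C.arcs → Mom3) (k : Config C.uncontracted)
    (i : N) (hi : i.1 ∈ C.uncontracted) (μ : Fin 4) :
    C.momenta m p k (i, μ) = k (⟨i, hi⟩, μ) := by
  simp only [momenta, hi, dite_true]
  rw [Finset.sum_eq_zero, zero_add]
  intro c _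
  have hu := (Finset.mem_sdiff.1 hi).2
  rw [if_neg, if_neg]
  · ring
  · exact fun h => hu (Finset.mem_union_right _ (Finset.mem_image.2 ⟨c.1, c.2, h⟩))
  · exact fun h => hu (Finset.mem_union_left _ (Finset.mem_image.2 ⟨c.1, c.2, h⟩))

lemma energy_temperate {m : ℝ} (hm : 0 < m) : (energy m).HasTemperateGrowth := by
  have h : energy m = fun p : Mom3 => m * (1 + ‖m⁻¹ • p‖ ^ 2) ^ (1 / 2 : ℝ) := by
    ext p
    rw [energy, ← Real.sqrt_eq_rpow, ← Real.sqrt_sq hm.le, ← Real.sqrt_mul (sq_nonneg _),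
      Real.sqrt_sq hm.le, norm_smul, norm_inv, Real.norm_of_nonneg hm.le]
    congr 1
    field_simp
  rw [h]
  exact (Function.HasTemperateGrowth.const m).mul
    ((Function.hasTemperateGrowth_one_add_norm_sq_rpow Mom3 (1 / 2)).comp
      (m⁻¹ • ContinuousLinearMap.id ℝ Mom3).hasTemperateGrowth)

lemma onShell_temperate {m : ℝ} (hm : 0 < m) (μ : Fin 4) :
    (fun p => onShell m p μ).HasTemperateGrowth := by
  refine Fin.cases ?_ (fun j => ?_) μ
  · simpa only [onShell, Matrix.cons_val_zero] using energy_temperate hm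
  · simp only [onShell, Matrix.cons_val_succ]
    exact (EuclideanSpace.proj j : Mom3 →L[ℝ] ℝ).hasTemperateGrowth

lemma ite_temperate {E : Type} [NormedAddCommGroup E] [NormedSpace ℝ E] (P : Prop) [Decidable P]
    {f : E → ℝ} (hf : f.HasTemperateGrowth) :
    (fun x => if P then f x else 0).HasTemperateGrowth := by
  by_cases h : P
  · simpa [h] using hf
  · simp [h]

lemma onShell_arc_temperate {m : ℝ} (hm : 0 < m) (c : C.arcs) (μ : Fin 4) :
    (fun z : (C.arcs → Mom3) × Config C.uncontracted => onShell m (z.1 c) μ).HasTemperateGrowth :=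
  (onShell_temperate hm μ).comp ((ContinuousLinearMap.proj (R := ℝ) (φ := fun _ : C.arcs => Mom3) c).comp
    (ContinuousLinearMap.fst ℝ (C.arcs → Mom3) (Config C.uncontracted))).hasTemperateGrowth

lemma config_coord_temperate (j : C.uncontracted × Fin 4) :
    (fun z : (C.arcs → Mom3) × Config C.uncontracted => z.2 j).HasTemperateGrowth :=
  ((EuclideanSpace.proj j : Config C.uncontracted →L[ℝ] ℝ).comp
    (ContinuousLinearMap.snd ℝ (C.arcs → Mom3) (Config C.uncontracted))).hasTemperateGrowth

lemma phase_temperate {m : ℝ} (hm : 0 < m) (σ : Matrix (Fin 4) (Fin 4) ℝ) :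
    (fun z : (C.arcs → Mom3) × Config C.uncontracted =>
      C.phase m σ z.1 z.2).HasTemperateGrowth := by
  unfold Contraction.phase twist
  refine .add (.sum fun c _ => .sum fun d _ => ite_temperate _ (.sum fun μ _ => .sum fun ν _ => ?_))
    (.sum fun c _ => .sum fun u _ => ite_temperate _ (.sum fun μ _ => .sum fun ν _ => ?_))
  · exact ((onShell_arc_temperate C hm c μ).mul (.const _)).mul (onShell_arc_temperate C hm d ν)
  · exact ((onShell_arc_temperate C hm c μ).mul (.const _)).mul (config_coord_temperate C (u, ν))

lemma momenta_temperate {m : ℝ} (hm : 0 < m) :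
    (fun z : (C.arcs → Mom3) × Config C.uncontracted =>
      C.momenta m z.1 z.2).HasTemperateGrowth := by
  have h : (fun z : (C.arcs → Mom3) × Config C.uncontracted => C.momenta m z.1 z.2) =
      fun z => ∑ j, C.momenta m z.1 z.2 j • EuclideanSpace.single j (1 : ℝ) := by
    ext z i
    simp [Finset.sum_apply, Pi.single_apply]
  rw [h]
  refine .sum fun j _ => Function.HasTemperateGrowth.smul
    (f := fun z : (C.arcs → Mom3) × Config C.uncontracted => C.momenta m z.1 z.2 j)
    (g := fun _ => EuclideanSpace.single j (1 : ℝ)) ?_ (.const _)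
  refine .add (.sum fun c _ => (Function.HasTemperateGrowth.const _).mul
    (onShell_arc_temperate C hm c j.2)) ?_
  by_cases hj : j.1.1 ∈ C.uncontracted
  · simpa [hj] using config_coord_temperate C (⟨j.1.1, hj⟩, j.2)
  · simp [hj]

lemma norm_le_momenta (m : ℝ) (z : (C.arcs → Mom3) × Config C.uncontracted) :
    ‖z‖ ≤ (1 + Fintype.card (C.uncontracted × Fin 4)) * (1 + ‖C.momenta m z.1 z.2‖) ^ 1 := by
  set R := ‖C.momenta m z.1 z.2‖
  have hR : 0 ≤ R := norm_nonneg _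
  have hco : ∀ j, |C.momenta m z.1 z.2 j| ≤ R := fun j => by
    simpa only [Real.norm_eq_abs] using PiLp.norm_apply_le (C.momenta m z.1 z.2) j
  have hc : (0 : ℝ) ≤ Fintype.card (C.uncontracted × Fin 4) := by positivity
  rw [pow_one, Prod.norm_def, max_le_iff]
  constructor
  · refine (pi_norm_le_iff_of_nonneg (by positivity)).2 fun c => ?_
    have h0 := hco (⟨c.1.1, (C.mem_and_lt c c.2).1⟩, 0)
    rw [C.momenta_fst m z.1 z.2 c _ rfl] at h0
    have : ‖z.1 c‖ ≤ R := (norm_le_energy m _).trans ((le_abs_self _).trans h0)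
    nlinarith [mul_nonneg hc hR]
  · have : ∀ j, |z.2 j| ≤ R := fun j => by
      have h0 := hco (⟨j.1.1, (Finset.mem_sdiff.1 j.1.2).1⟩, j.2)
      rwa [C.momenta_uncontracted m z.1 z.2 _ j.1.2] at h0
    have h2 := (Config.norm_le_sum z.2).trans (Finset.sum_le_sum fun j _ => this j)
    rw [Finset.sum_const, Finset.card_univ, nsmul_eq_mul] at h2
    nlinarith [mul_nonneg hc hR]

/-- The integrand of the quantum contraction, as a Schwartz function of all its variables. -/
noncomputable def contractionIntegrand {m : ℝ} (hm : 0 < m) (σ : Matrix (Fin 4) (Fin 4) ℝ)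
    (F : 𝓢(Config N, ℂ)) : 𝓢((C.arcs → Mom3) × Config C.uncontracted, ℂ) :=
  SchwartzMap.smulLeftCLM ℂ
    (fun z => Complex.exp ((-C.phase m σ z.1 z.2 : ℝ) * Complex.I))
    (SchwartzMap.compCLM ℂ (momenta_temperate C hm) ⟨1, _, norm_le_momenta C m⟩ F)

lemma contractionIntegrand_apply {m : ℝ} (hm : 0 < m) (σ : Matrix (Fin 4) (Fin 4) ℝ)
    (F : 𝓢(Config N, ℂ)) (p : C.arcs → Mom3) (k : Config C.uncontracted) :
    contractionIntegrand C hm σ F (p, k) =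
      Complex.exp (-Complex.I * C.phase m σ p k) * F (C.momenta m p k) := by
  have h : (fun z : (C.arcs → Mom3) × Config C.uncontracted =>
      Complex.exp ((-C.phase m σ z.1 z.2 : ℝ) * Complex.I)).HasTemperateGrowth :=
    hasTemperateGrowth_expI.comp (phase_temperate C hm σ).neg
  rw [contractionIntegrand, SchwartzMap.smulLeftCLM_apply_apply h]
  simp [mul_comm]

/-- The quantum contraction in momentum space:
`F ↦ (2π)^{8|A|} ∫ dμ(k_A) e^{-i⟨k_A, I k_A⟩ - i⟨k_A, E k_U⟩} F(k_N)` at `k_{α(A)} = -k_A`. -/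
noncomputable def contractMomentum {m : ℝ} (hm : 0 < m) (σ : Matrix (Fin 4) (Fin 4) ℝ)
    (F : 𝓢(Config N, ℂ)) : 𝓢(Config C.uncontracted, ℂ) :=
  haveI := pi_massShell_temperate hm C.arcs
  (2 * π : ℂ) ^ (8 * C.arcs.card) •
    { toFun := fun k => ∫ p : C.arcs → Mom3,
        Complex.exp (-Complex.I * C.phase m σ p k) * F (C.momenta m p k)
          ∂(Measure.pi fun _ => massShell m)
      smooth' := by
        refine contDiff_infty.2 fun n => ?_
        simpa only [contractionIntegrand_apply] using
          (schwartz_partial_integral (Measure.pi fun _ : C.arcs => massShell m) n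
            (contractionIntegrand C hm σ F)).1
      decay' := fun b n => by
        simpa only [contractionIntegrand_apply] using
          (schwartz_partial_integral (Measure.pi fun _ : C.arcs => massShell m) n
            (contractionIntegrand C hm σ F)).2 b }

/-- The quantum contraction map `γ^C`, over the point `σ` of the joint spectrum of the `Q^{μν}`;
its transform is given in `fourierCheck_gamma`. -/
noncomputable def Contraction.gamma {m : ℝ} (hm : 0 < m) (σ : Matrix (Fin 4) (Fin 4) ℝ)
    (f : 𝓢(Config N, ℂ)) : 𝓢(Config C.uncontracted, ℂ) :=
  fourierSynth (contractMomentum C hm σ (fourierCheck f))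

theorem fourierCheck_gamma {m : ℝ} (hm : 0 < m) (σ : Matrix (Fin 4) (Fin 4) ℝ)
    (f : 𝓢(Config N, ℂ)) (k : Config C.uncontracted) :
    fourierCheck (C.gamma hm σ f) k =
      (2 * π : ℂ) ^ (8 * C.arcs.card) * ∫ p : C.arcs → Mom3,
        Complex.exp (-Complex.I * C.phase m σ p k) * fourierCheck f (C.momenta m p k)
          ∂(Measure.pi fun _ => massShell m) := by
  rw [Contraction.gamma, fourierCheck_fourierSynth]
  rfl

end Gamma

lemma schwartz_tensor_bound {E E₁ E₂ : Type} [NormedAddCommGroup E] [NormedSpace ℝ E]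
    [NormedAddCommGroup E₁] [NormedSpace ℝ E₁] [NormedAddCommGroup E₂] [NormedSpace ℝ E₂]
    (R : E →L[ℝ] E₁) (S : E →L[ℝ] E₂) (hRS : ∀ x, ‖x‖ ≤ ‖R x‖ + ‖S x‖)
    (f : 𝓢(E₁, ℂ)) (g : 𝓢(E₂, ℂ)) (k n : ℕ) :
    ∃ C : ℝ, ∀ x, ‖x‖ ^ k * ‖iteratedFDeriv ℝ n (fun x => f (R x) * g (S x)) x‖ ≤ C := by
  have hf (i : ℕ) : ∃ A : ℝ, 0 ≤ A ∧ ∀ x, (1 + ‖R x‖) ^ k * ‖iteratedFDeriv ℝ i (f ∘ R) x‖ ≤ A := by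
    refine ⟨2 ^ k * ((Finset.Iic (k, i)).sup fun m => SchwartzMap.seminorm ℝ m.1 m.2) f * ‖R‖ ^ i,
      by positivity, fun x => ?_⟩
    have h := SchwartzMap.one_add_le_sup_seminorm_apply (𝕜 := ℝ) (m := (k, i)) le_rfl le_rfl f (R x)
    have h2 : ‖iteratedFDeriv ℝ i (f ∘ R) x‖ ≤ ‖iteratedFDeriv ℝ i f (R x)‖ * ‖R‖ ^ i := by
      rw [R.iteratedFDeriv_comp_right (f.smooth i) x le_rfl]
      simpa using (iteratedFDeriv ℝ i f (R x)).norm_compContinuousLinearMap_le fun _ => R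
    calc _ ≤ (1 + ‖R x‖) ^ k * (‖iteratedFDeriv ℝ i f (R x)‖ * ‖R‖ ^ i) := by gcongr
      _ = ((1 + ‖R x‖) ^ k * ‖iteratedFDeriv ℝ i f (R x)‖) * ‖R‖ ^ i := by ring
      _ ≤ _ := by gcongr
  have hg (i : ℕ) : ∃ A : ℝ, 0 ≤ A ∧ ∀ x, (1 + ‖S x‖) ^ k * ‖iteratedFDeriv ℝ i (g ∘ S) x‖ ≤ A := by
    refine ⟨2 ^ k * ((Finset.Iic (k, i)).sup fun m => SchwartzMap.seminorm ℝ m.1 m.2) g * ‖S‖ ^ i,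
      by positivity, fun x => ?_⟩
    have h := SchwartzMap.one_add_le_sup_seminorm_apply (𝕜 := ℝ) (m := (k, i)) le_rfl le_rfl g (S x)
    have h2 : ‖iteratedFDeriv ℝ i (g ∘ S) x‖ ≤ ‖iteratedFDeriv ℝ i g (S x)‖ * ‖S‖ ^ i := by
      rw [S.iteratedFDeriv_comp_right (g.smooth i) x le_rfl]
      simpa using (iteratedFDeriv ℝ i g (S x)).norm_compContinuousLinearMap_le fun _ => S
    calc _ ≤ (1 + ‖S x‖) ^ k * (‖iteratedFDeriv ℝ i g (S x)‖ * ‖S‖ ^ i) := by gcongr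
      _ = ((1 + ‖S x‖) ^ k * ‖iteratedFDeriv ℝ i g (S x)‖) * ‖S‖ ^ i := by ring
      _ ≤ _ := by gcongr
  choose A hA hAf using hf
  choose B hB hBg using hg
  refine ⟨∑ i ∈ Finset.range (n + 1), n.choose i * A i * B (n - i), fun x => ?_⟩
  have h := norm_iteratedFDeriv_mul_le (N := ∞) (n := n) ((f.smooth ⊤).comp R.contDiff)
    ((g.smooth ⊤).comp S.contDiff) x (mod_cast le_top)
  have hx : ‖x‖ ^ k ≤ (1 + ‖R x‖) ^ k * (1 + ‖S x‖) ^ k := by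
    rw [← mul_pow]
    have := hRS x
    gcongr
    nlinarith [mul_nonneg (norm_nonneg (R x)) (norm_nonneg (S x))]
  calc _ ≤ (1 + ‖R x‖) ^ k * (1 + ‖S x‖) ^ k * ∑ i ∈ Finset.range (n + 1), (n.choose i : ℝ) *
        ‖iteratedFDeriv ℝ i (f ∘ R) x‖ * ‖iteratedFDeriv ℝ (n - i) (g ∘ S) x‖ := by
        gcongr; exact h
    _ = ∑ i ∈ Finset.range (n + 1), (n.choose i : ℝ) *
        ((1 + ‖R x‖) ^ k * ‖iteratedFDeriv ℝ i (f ∘ R) x‖) *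
        ((1 + ‖S x‖) ^ k * ‖iteratedFDeriv ℝ (n - i) (g ∘ S) x‖) := by
        rw [Finset.mul_sum]; exact Finset.sum_congr rfl fun i _ => by ring
    _ ≤ _ := by
        refine Finset.sum_le_sum fun i _ => ?_
        have := hAf i x
        have := hBg (n - i) x
        have := hA i
        gcongr

lemma norm_le_restrictConfig (N M : Finset ℕ) (x : Config (N ∪ M)) :
    ‖x‖ ≤ ‖restrictConfig Finset.subset_union_left x‖ +
      ‖restrictConfig Finset.subset_union_right x‖ := by
  let G : ℕ → ℝ := fun i => if h : i ∈ N ∪ M then ∑ μ, x (⟨i, h⟩, μ) ^ 2 else 0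
  have hG : ∀ i, 0 ≤ G i := fun i => by
    by_cases h : i ∈ N ∪ M
    · simp only [G, h, dite_true]; positivity
    · simp only [G, h, dite_false]; exact le_rfl
  have key : ∀ (S : Finset ℕ) (h : S ⊆ N ∪ M), ‖restrictConfig h x‖ ^ 2 = ∑ i ∈ S, G i := by
    intro S h
    rw [EuclideanSpace.norm_sq_eq, Fintype.sum_prod_type, ← Finset.sum_coe_sort S G]
    refine Finset.sum_congr rfl fun i _ => ?_
    simp only [G, h i.2, dite_true, Real.norm_eq_abs, sq_abs]
    rfl
  have h0 : ‖x‖ ^ 2 = ∑ i ∈ N ∪ M, G i := key _ subset_rfl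
  have h1 := key N Finset.subset_union_left
  have h2 := key M Finset.subset_union_right
  have h3 := Finset.sum_union_inter (s₁ := N) (s₂ := M) (f := G)
  have h4 : 0 ≤ ∑ i ∈ N ∩ M, G i := Finset.sum_nonneg fun i _ => hG i
  refine le_of_sq_le_sq ?_ (by positivity)
  nlinarith [mul_nonneg (norm_nonneg (restrictConfig (Finset.subset_union_left (s₁ := N) (s₂ := M)) x))
    (norm_nonneg (restrictConfig (Finset.subset_union_right (s₁ := N) (s₂ := M)) x))]

/-- The tensor product `(f ⊗ g)(x) = f(x_N) g(x_M)`. -/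
noncomputable def tensor {N M : Finset ℕ} (f : 𝓢(Config N, ℂ)) (g : 𝓢(Config M, ℂ)) :
    𝓢(Config (N ∪ M), ℂ) where
  toFun x := f (restrictConfig Finset.subset_union_left x) *
    g (restrictConfig Finset.subset_union_right x)
  smooth' := ((f.smooth ⊤).comp (ContinuousLinearMap.contDiff _)).mul
    ((g.smooth ⊤).comp (ContinuousLinearMap.contDiff _))
  decay' := schwartz_tensor_bound _ _ (norm_le_restrictConfig N M) f g

/-! ### Fields on the noncommutative Minkowski space -/

/-- A regular representation of the quantum coordinates `q^μ` over the point `σ` of the joint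
spectrum of their commutators: the Weyl operators `weyl α = e^{iαq}` are unitary, strongly continuous
in `α`, and satisfy `e^{iαq} e^{iβq} = e^{i(α+β)q} e^{-(i/2) α σ β}`. -/
structure RegularRep (σ : Matrix (Fin 4) (Fin 4) ℝ) (H : Type*) [NormedAddCommGroup H]
    [InnerProductSpace ℂ H] where
  weyl : Mom → H ≃ₗᵢ[ℂ] H
  weyl_mul : ∀ α β x, weyl α (weyl β x) =
    Complex.exp (-(Complex.I / 2) * twist σ α β) • weyl (α + β) x
  continuous_weyl : ∀ x, Continuous fun α => weyl α x

/-- Sequences of `H`-valued `l`-particle wave functions in momentum space. -/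
abbrev FockFun (H : Type*) := (l : ℕ) → (Fin l → Mom3) → H

section Fields

variable {σ : Matrix (Fin 4) (Fin 4) ℝ} {H : Type*} [NormedAddCommGroup H]
  [InnerProductSpace ℂ H]

variable (H) in
/-- The domain of the fields in `ℋ_φ ⊗ H`, where `ℋ_φ` is the symmetric Fock space over the mass
shell with the measure `massShell m`: finite sequences of symmetric, continuous, rapidly
decreasing `H`-valued wave functions. -/
def fockDomain : Submodule ℂ (FockFun H) where
  carrier := {Ψ | (∀ l, Continuous (Ψ l)) ∧
    (∀ l n : ℕ, ∃ C : ℝ, ∀ q, (1 + ‖q‖) ^ n * ‖Ψ l q‖ ≤ C) ∧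
    (∀ l (τ : Equiv.Perm (Fin l)) q, Ψ l (q ∘ τ) = Ψ l q) ∧
    ∃ L, ∀ l ≥ L, Ψ l = 0}
  add_mem' := by
    rintro Ψ Φ ⟨h1, h2, h3, L, h4⟩ ⟨h1', h2', h3', L', h4'⟩
    refine ⟨fun l => (h1 l).add (h1' l), fun l n => ?_, fun l τ q => ?_, max L L', fun l hl => ?_⟩
    · obtain ⟨C, hC⟩ := h2 l n
      obtain ⟨C', hC'⟩ := h2' l n
      refine ⟨C + C', fun q => ?_⟩
      calc _ ≤ (1 + ‖q‖) ^ n * (‖Ψ l q‖ + ‖Φ l q‖) := by gcongr; exact norm_add_le _ _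
        _ ≤ _ := by rw [mul_add]; exact add_le_add (hC q) (hC' q)
    · simp [h3, h3']
    · simp [h4 l (le_trans (le_max_left _ _) hl), h4' l (le_trans (le_max_right _ _) hl)]
  zero_mem' := ⟨fun l => continuous_const, fun l n => ⟨0, by simp⟩, by simp, 0, by simp⟩
  smul_mem' := by
    rintro c Ψ ⟨h1, h2, h3, L, h4⟩
    refine ⟨fun l => (h1 l).const_smul c, fun l n => ?_, fun l τ q => ?_, L, fun l hl => ?_⟩
    · obtain ⟨C, hC⟩ := h2 l n
      refine ⟨‖c‖ * C, fun q => ?_⟩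
      rw [Pi.smul_apply, Pi.smul_apply, norm_smul, mul_left_comm]
      gcongr
      exact hC q
    · simp [h3]
    · simp [h4 l hl]

/-- `∫ dμ(k) a*(k) ⊗ e^{ikq} G(-k)`, for creation operators with
`[a(k), a*(k')] = (2π)³ 2 ω_𝐤 δ(𝐤 - 𝐤')`. The values of `G` are applied to the right. -/
noncomputable def creationPart (m : ℝ) (W : RegularRep σ H) (G : Mom → FockFun H) : FockFun H
  | 0, _ => 0
  | l + 1, q => (√(l + 1))⁻¹ • ∑ r : Fin (l + 1),
      W.weyl (onShell m (q r)) (G (-onShell m (q r)) l (q ∘ r.succAbove))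

/-- `∫ dμ(k) a(k) ⊗ e^{-ikq} G(k)`. -/
noncomputable def annihilationPart (m : ℝ) (W : RegularRep σ H) (G : Mom → FockFun H) :
    FockFun H := fun l q =>
  √(l + 1) • ∫ p, W.weyl (-onShell m p) (G (onShell m p) (l + 1) (Matrix.vecCons p q)) ∂massShell m

/-- `(2π)⁴ ∫ dμ(k) (a(k) ⊗ e^{-ikq} G(k) + a*(k) ⊗ e^{ikq} G(-k))`. If `G = f̌`, this is the smeared
free field `∫ dx φ(q + x) f(x)` with `φ(x) = ∫ dμ(k) (a(k) e^{-ikx} + a*(k) e^{ikx})`. -/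
noncomputable def smearedField (m : ℝ) (W : RegularRep σ H) (G : Mom → FockFun H) : FockFun H :=
  (2 * π) ^ 4 • (annihilationPart m W G + creationPart m W G)

/-- `∫ dx φ(q + x_1) ⋯ φ(q + x_n) f(x_1, …, x_n) Ψ`, where `F = f̌`. -/
noncomputable def fieldProduct (m : ℝ) (W : RegularRep σ H) :
    (n : ℕ) → ((Fin n → Mom) → ℂ) → FockFun H → FockFun H
  | 0, F, Ψ => F Fin.elim0 • Ψ
  | n + 1, F, Ψ => smearedField m W fun k =>
      fieldProduct m W n (fun k' => F (Matrix.vecCons k k')) Ψ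

/-- Joint continuity and rapid decay of a family of elements of the domain. -/
structure NiceFamily {X : Type} [NormedAddCommGroup X] (G : X → FockFun H) : Prop where
  cont : ∀ l, Continuous fun z : X × (Fin l → Mom3) => G z.1 l z.2
  decay : ∀ l n : ℕ, ∃ C : ℝ, ∀ x q, (1 + ‖x‖) ^ n * ((1 + ‖q‖) ^ n * ‖G x l q‖) ≤ C
  symm : ∀ x l (τ : Equiv.Perm (Fin l)) q, G x l (q ∘ τ) = G x l q
  fin : ∃ L, ∀ x, ∀ l ≥ L, G x l = 0

lemma continuous_weyl_apply (W : RegularRep σ H) {Y : Type*} [TopologicalSpace Y] {a : Y → Mom}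
    {h : Y → H} (ha : Continuous a) (hh : Continuous h) :
    Continuous fun y => W.weyl (a y) (h y) := by
  refine continuous_iff_continuousAt.2 fun y₀ => ?_
  have h1 : Filter.Tendsto (fun y => ‖h y - h y₀‖ + ‖W.weyl (a y) (h y₀) - W.weyl (a y₀) (h y₀)‖)
      (nhds y₀) (nhds 0) := by
    have e1 : Continuous fun y => ‖h y - h y₀‖ + ‖W.weyl (a y) (h y₀) - W.weyl (a y₀) (h y₀)‖ :=
      (hh.sub continuous_const).norm.add
        ((((W.continuous_weyl (h y₀)).comp ha).sub continuous_const).norm)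
    simpa using e1.tendsto y₀
  refine tendsto_iff_norm_sub_tendsto_zero.2
    (squeeze_zero (fun _ => norm_nonneg _) (fun y => ?_) h1)
  calc ‖W.weyl (a y) (h y) - W.weyl (a y₀) (h y₀)‖
      = ‖W.weyl (a y) (h y - h y₀) + (W.weyl (a y) (h y₀) - W.weyl (a y₀) (h y₀))‖ := by
        rw [map_sub]; congr 1; abel
    _ ≤ _ := (norm_add_le _ _).trans (by rw [LinearIsometryEquiv.norm_map])

section Stability

variable {X : Type} [NormedAddCommGroup X] {m : ℝ} (W : RegularRep σ H)
  {G : X × Mom → FockFun H}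

lemma NiceFamily.annihilation_bound (hG : NiceFamily G) (l n a : ℕ) :
    ∃ C : ℝ, 0 ≤ C ∧ ∀ x p q, (1 + ‖x‖) ^ n * ((1 + ‖q‖) ^ n *
      ‖W.weyl (-onShell m p) (G (x, onShell m p) (l + 1) (Matrix.vecCons p q))‖) ≤
        C * (1 + ‖p‖) ^ (-(a : ℝ)) := by
  obtain ⟨C, hC⟩ := hG.decay (l + 1) (n + a)
  have hC0 : 0 ≤ C := le_trans (by positivity) (hC 0 0)
  refine ⟨C, hC0, fun x p q => ?_⟩
  rw [LinearIsometryEquiv.norm_map, Real.rpow_neg (by positivity), Real.rpow_natCast,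
    ← div_eq_mul_inv, le_div_iff₀ (by positivity)]
  refine le_trans ?_ (hC (x, onShell m p) (Matrix.vecCons p q))
  have h1 : ‖x‖ ≤ ‖(x, onShell m p)‖ := norm_fst_le (x, onShell m p)
  have h2 : ‖p‖ ≤ ‖(x, onShell m p)‖ := (norm_le_onShell m p).trans (norm_snd_le (x, onShell m p))
  have h3 : ‖q‖ ≤ ‖(Matrix.vecCons p q)‖ :=
    (pi_norm_le_iff_of_nonneg (norm_nonneg _)).2 fun i => by
      simpa using norm_le_pi_norm (Matrix.vecCons p q) i.succ
  calc _ = ((1 + ‖x‖) ^ n * (1 + ‖p‖) ^ a) *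
        ((1 + ‖q‖) ^ n * ‖G (x, onShell m p) (l + 1) (Matrix.vecCons p q)‖) := by ring
    _ ≤ ((1 + ‖(x, onShell m p)‖) ^ n * (1 + ‖(x, onShell m p)‖) ^ a) *
        ((1 + ‖(Matrix.vecCons p q)‖) ^ (n + a) *
          ‖G (x, onShell m p) (l + 1) (Matrix.vecCons p q)‖) := by
        gcongr
        refine le_trans ?_ (pow_le_pow_right₀ (by simp) (Nat.le_add_right n a))
        gcongr
    _ = _ := by rw [← pow_add]

lemma NiceFamily.annihilation_continuous (hG : NiceFamily G) (l : ℕ) :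
    Continuous fun z : (X × (Fin l → Mom3)) × Mom3 =>
      W.weyl (-onShell m z.2) (G (z.1.1, onShell m z.2) (l + 1) (Matrix.vecCons z.2 z.1.2)) := by
  have ho : Continuous fun z : (X × (Fin l → Mom3)) × Mom3 => onShell m z.2 :=
    (continuous_onShell m).comp continuous_snd
  refine continuous_weyl_apply W ho.neg ((hG.cont (l + 1)).comp
    (((continuous_fst.comp continuous_fst).prodMk ho).prodMk
      (continuous_snd.matrixVecCons (continuous_snd.comp continuous_fst))))

lemma NiceFamily.annihilation_integrable (hm : 0 < m) (hG : NiceFamily G) (x : X) (l : ℕ)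
    (q : Fin l → Mom3) :
    Integrable (fun p => W.weyl (-onShell m p) (G (x, onShell m p) (l + 1) (Matrix.vecCons p q)))
      (massShell m) := by
  have := massShell_temperate hm
  obtain ⟨C, hC, h⟩ := hG.annihilation_bound (m := m) W l 0 (massShell m).integrablePower
  have h1 : Continuous fun p : Mom3 => ((x, q), p) := by fun_prop
  have h2 := (hG.annihilation_continuous (m := m) W l).comp h1
  have h3 := ((massShell m).integrable_pow_neg_integrablePower.const_mul C)
  have h4 : AEStronglyMeasurable (fun p => W.weyl (-onShell m p) (G (x, onShell m p) (l + 1) (Matrix.vecCons p q))) (massShell m) := by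
     exact h2.aestronglyMeasurable
  refine h3.mono' h4 (.of_forall fun p => ?_)
  have h5 := h x p q
  rw [pow_zero, pow_zero, one_mul, one_mul] at h5
  exact h5

lemma NiceFamily.annihilation_nice (hm : 0 < m) (hG : NiceFamily G) :
    NiceFamily fun x => annihilationPart m W fun k => G (x, k) := by
  have := massShell_temperate hm
  have hint := (massShell m).integrable_pow_neg_integrablePower
  refine ⟨fun l => ?_, fun l n => ?_, fun x l τ q => ?_, ?_⟩
  · obtain ⟨C, hC, h⟩ := hG.annihilation_bound (m := m) W l 0 (massShell m).integrablePower
    have h0 : ∀ x p q, ‖W.weyl (-onShell m p) (G (x, onShell m p) (l + 1) (Matrix.vecCons p q))‖ ≤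
        C * (1 + ‖p‖) ^ (-((massShell m).integrablePower : ℝ)) := fun x p q => by
      have h5 := h x p q
      rwa [pow_zero, pow_zero, one_mul, one_mul] at h5
    have h1 : Continuous fun z : X × (Fin l → Mom3) => ∫ p, W.weyl (-onShell m p)
        (G (z.1, onShell m p) (l + 1) (Matrix.vecCons p z.2)) ∂massShell m := by
      have hb := hint.const_mul C
      have hm' := fun z : X × (Fin l → Mom3) =>
        (hG.annihilation_integrable W hm z.1 l z.2).aestronglyMeasurable
      refine continuous_of_dominated hm' (fun z => .of_forall fun p => ?_) hb
        (.of_forall fun p => ?_)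
      · exact h0 z.1 p z.2
      have h2 : Continuous fun z : X × (Fin l → Mom3) => (z, p) := by fun_prop
      have h3 := (hG.annihilation_continuous (m := m) W l).comp h2
      exact h3
    simp only [annihilationPart]
    exact h1.const_smul (√((l : ℝ) + 1))
  · obtain ⟨C, hC, h⟩ := hG.annihilation_bound (m := m) W l n (massShell m).integrablePower
    refine ⟨√(l + 1) * ∫ p, C * (1 + ‖p‖) ^ (-((massShell m).integrablePower : ℝ)) ∂massShell m,
      fun x q => ?_⟩
    have hi := hG.annihilation_integrable W hm x l q
    rw [annihilationPart, norm_smul, Real.norm_of_nonneg (Real.sqrt_nonneg _)]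
    calc _ = √(l + 1) * ((1 + ‖x‖) ^ n * ((1 + ‖q‖) ^ n * ‖∫ p, W.weyl (-onShell m p)
          (G (x, onShell m p) (l + 1) (Matrix.vecCons p q)) ∂massShell m‖)) := by ring
      _ ≤ √(l + 1) * ((1 + ‖x‖) ^ n * ((1 + ‖q‖) ^ n * ∫ p, ‖W.weyl (-onShell m p)
          (G (x, onShell m p) (l + 1) (Matrix.vecCons p q))‖ ∂massShell m)) := by
          gcongr; exact norm_integral_le_integral_norm _
      _ ≤ _ := by
          rw [← integral_const_mul, ← integral_const_mul]
          exact mul_le_mul_of_nonneg_left (integral_mono ((hi.norm.const_mul _).const_mul _)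
            (hint.const_mul C) fun p => h x p q) (Real.sqrt_nonneg _)
  · simp only [annihilationPart]
    congr 2
    ext p
    congr 1
    have : Matrix.vecCons p (q ∘ τ) =
        (Matrix.vecCons p q) ∘ Equiv.Perm.decomposeFin.symm (0, τ) := by
      ext i : 1
      refine Fin.cases ?_ (fun j => ?_) i
      · simp
      · simp
    rw [this, hG.symm]
  · obtain ⟨L, hL⟩ := hG.fin
    refine ⟨L, fun x l hl => ?_⟩
    ext q
    simp [annihilationPart, hL _ (l + 1) (by omega)]

lemma NiceFamily.creation_nice (hG : NiceFamily G) :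
    NiceFamily fun x => creationPart m W fun k => G (x, k) := by
  refine ⟨fun l => ?_, fun l n => ?_, fun x l τ q => ?_, ?_⟩
  · cases l with
    | zero => exact continuous_const
    | succ l =>
      refine Continuous.const_smul (continuous_finsetSum _ fun r _ => ?_) _
      have ho : Continuous fun z : X × (Fin (l + 1) → Mom3) => onShell m (z.2 r) :=
        (continuous_onShell m).comp (by fun_prop)
      refine continuous_weyl_apply W ho ((hG.cont l).comp
        ((continuous_fst.prodMk ho.neg).prodMk (continuous_pi fun i => ?_)))
      fun_prop
  · cases l with
    | zero => exact ⟨0, fun x q => by simp [creationPart]⟩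
    | succ l =>
      obtain ⟨C, hC⟩ := hG.decay l (n + n)
      refine ⟨(√(l + 1))⁻¹ * ∑ r : Fin (l + 1), C, fun x q => ?_⟩
      simp only [creationPart]
      rw [norm_smul, Real.norm_of_nonneg (by positivity)]
      calc _ = (√(l + 1))⁻¹ * ((1 + ‖x‖) ^ n * ((1 + ‖q‖) ^ n * ‖∑ r : Fin (l + 1),
            W.weyl (onShell m (q r)) (G (x, -onShell m (q r)) l (q ∘ r.succAbove))‖)) := by ring
        _ ≤ (√(l + 1))⁻¹ * ((1 + ‖x‖) ^ n * ((1 + ‖q‖) ^ n * ∑ r : Fin (l + 1),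
            ‖G (x, -onShell m (q r)) l (q ∘ r.succAbove)‖)) := by
            gcongr
            refine (norm_sum_le _ _).trans_eq (Finset.sum_congr rfl fun r _ => ?_)
            rw [LinearIsometryEquiv.norm_map]
        _ ≤ _ := by
            rw [Finset.mul_sum, Finset.mul_sum]
            gcongr with r
            refine le_trans ?_ (hC (x, -onShell m (q r)) (q ∘ r.succAbove))
            set y := (x, -onShell m (q r))
            have h1 : ‖x‖ ≤ ‖y‖ := norm_fst_le y
            have h2 : ‖q r‖ ≤ ‖y‖ := (norm_le_onShell m (q r)).trans
              ((norm_neg _).symm.le.trans (norm_snd_le y))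
            have h3 : 1 + ‖q‖ ≤ (1 + ‖y‖) * (1 + ‖q ∘ r.succAbove‖) := by
              have : ‖q‖ ≤ ‖y‖ + ‖q ∘ r.succAbove‖ :=
                (pi_norm_le_iff_of_nonneg (by positivity)).2 fun i => by
                  rcases Fin.eq_self_or_eq_succAbove r i with h | ⟨j, h⟩
                  · rw [h]; exact h2.trans (by simp)
                  · rw [h]
                    exact (norm_le_pi_norm (q ∘ r.succAbove) j).trans (by simp)
              nlinarith [mul_nonneg (norm_nonneg y) (norm_nonneg (q ∘ r.succAbove))]
            calc _ ≤ (1 + ‖y‖) ^ n * (((1 + ‖y‖) * (1 + ‖q ∘ r.succAbove‖)) ^ n *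
                  ‖G y l (q ∘ r.succAbove)‖) := by gcongr
              _ = (1 + ‖y‖) ^ (n + n) * ((1 + ‖q ∘ r.succAbove‖) ^ n *
                  ‖G y l (q ∘ r.succAbove)‖) := by rw [mul_pow, pow_add]; ring
              _ ≤ _ := by
                  gcongr
                  · simp
                  · omega
  · cases l with
    | zero => simp [creationPart]
    | succ l =>
      simp only [creationPart]
      congr 1
      refine Fintype.sum_equiv τ _ _ fun r => ?_
      have : (q ∘ τ) ∘ r.succAbove = (q ∘ (τ r).succAbove) ∘
          ((finSuccAboveEquiv r).trans ((τ.subtypeEquiv fun i => by simp).trans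
            (finSuccAboveEquiv (τ r)).symm)) := by
        ext i : 1
        have h := (finSuccAboveEquiv (τ r)).apply_symm_apply
          ⟨τ (r.succAbove i), by simp [Fin.succAbove_ne]⟩
        have h' := congrArg Subtype.val h
        rw [finSuccAboveEquiv_apply] at h'
        simp only [Function.comp_apply]
        exact congrArg q h'.symm
      rw [this, hG.symm]
      rfl
  · obtain ⟨L, hL⟩ := hG.fin
    refine ⟨L + 1, fun x l hl => ?_⟩
    obtain ⟨l, rfl⟩ : ∃ l', l = l' + 1 := ⟨l - 1, by omega⟩
    ext q
    simp [creationPart, hL _ l (by omega)]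

lemma NiceFamily.smearedField_nice (hm : 0 < m) (hG : NiceFamily G) :
    NiceFamily fun x => smearedField m W fun k => G (x, k) := by
  have hA := hG.annihilation_nice W hm
  have hC := hG.creation_nice (m := m) W
  refine ⟨fun l => ((hA.cont l).add (hC.cont l)).const_smul _, fun l n => ?_, fun x l τ q => ?_, ?_⟩
  · obtain ⟨C, h⟩ := hA.decay l n
    obtain ⟨C', h'⟩ := hC.decay l n
    refine ⟨(2 * π) ^ 4 * (C + C'), fun x q => ?_⟩
    simp only [smearedField, Pi.smul_apply, Pi.add_apply]
    rw [norm_smul, Real.norm_of_nonneg (by positivity)]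
    set u := annihilationPart m W (fun k => G (x, k)) l q
    set v := creationPart m W (fun k => G (x, k)) l q
    calc _ ≤ (1 + ‖x‖) ^ n * ((1 + ‖q‖) ^ n * ((2 * π) ^ 4 * (‖u‖ + ‖v‖))) := by
          gcongr; exact norm_add_le _ _
      _ = (2 * π) ^ 4 * ((1 + ‖x‖) ^ n * ((1 + ‖q‖) ^ n * ‖u‖) +
          (1 + ‖x‖) ^ n * ((1 + ‖q‖) ^ n * ‖v‖)) := by ring
      _ ≤ _ := by
          gcongr
          · exact h x q
          · exact h' x q
  · simp only [smearedField, Pi.smul_apply, Pi.add_apply]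
    rw [hA.symm, hC.symm]
  · obtain ⟨L, hL⟩ := hA.fin
    obtain ⟨L', hL'⟩ := hC.fin
    refine ⟨max L L', fun x l hl => ?_⟩
    simp only [smearedField, Pi.smul_apply, Pi.add_apply]
    rw [hL x l (le_trans (le_max_left _ _) hl), hL' x l (le_trans (le_max_right _ _) hl)]
    simp

end Stability

/-- Joint continuity and rapid decay of a family of momentum functions. -/
def NiceSymbol {X : Type} [NormedAddCommGroup X] {n : ℕ} (F : X → (Fin n → Mom) → ℂ) : Prop :=
  (Continuous fun z : X × (Fin n → Mom) => F z.1 z.2) ∧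
    ∀ a : ℕ, ∃ C : ℝ, ∀ x k, (1 + ‖x‖) ^ a * ((1 + ‖k‖) ^ a * ‖F x k‖) ≤ C

lemma NiceSymbol.cons {X : Type} [NormedAddCommGroup X] {n : ℕ} {F : X → (Fin (n + 1) → Mom) → ℂ}
    (hF : NiceSymbol F) :
    NiceSymbol fun (z : X × Mom) (k' : Fin n → Mom) => F z.1 (Matrix.vecCons z.2 k') := by
  refine ⟨hF.1.comp ((continuous_fst.comp continuous_fst).prodMk 
    ((continuous_snd.comp continuous_fst).matrixVecCons continuous_snd)), fun a => ?_⟩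
  · obtain ⟨C, hC⟩ := hF.2 (a + a)
    refine ⟨C, fun z k => le_trans ?_ (hC z.1 (Matrix.vecCons z.2 k))⟩
    set y : Fin (n + 1) → Mom := Matrix.vecCons z.2 k
    have h1 : ‖z.2‖ ≤ ‖y‖ := by simpa [y] using norm_le_pi_norm y 0
    have h2 : ‖k‖ ≤ ‖y‖ := (pi_norm_le_iff_of_nonneg (norm_nonneg _)).2 fun i => by
      simpa [y] using norm_le_pi_norm y i.succ
    have h3 : 1 + ‖z‖ ≤ (1 + ‖z.1‖) * (1 + ‖y‖) := by
      have : ‖z‖ ≤ ‖z.1‖ + ‖y‖ := by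
        rw [Prod.norm_def]
        exact max_le (by simp) (h1.trans (by simp))
      nlinarith [mul_nonneg (norm_nonneg z.1) (norm_nonneg y)]
    calc _ ≤ ((1 + ‖z.1‖) * (1 + ‖y‖)) ^ a * ((1 + ‖y‖) ^ a * ‖F z.1 y‖) := by gcongr
      _ = (1 + ‖z.1‖) ^ a * ((1 + ‖y‖) ^ (a + a) * ‖F z.1 y‖) := by
          rw [mul_pow, pow_add]; ring
      _ ≤ _ := by
          gcongr
          · simp
          · omega

lemma fieldProduct_nice {m : ℝ} (hm : 0 < m) (W : RegularRep σ H) {Ψ : FockFun H}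
    (hΨ : Ψ ∈ fockDomain H) (n : ℕ) : ∀ {X : Type} [NormedAddCommGroup X]
    (F : X → (Fin n → Mom) → ℂ), NiceSymbol F →
    NiceFamily fun x => fieldProduct m W n (F x) Ψ := by
  induction n with
  | zero =>
    intro X _ F hF
    obtain ⟨h1, h2, h3, L, h4⟩ := hΨ
    refine ⟨fun l => ?_, fun l a => ?_, fun x l τ q => ?_, L, fun x l hl => ?_⟩
    · exact (hF.1.comp (continuous_fst.prodMk continuous_const)).smul ((h1 l).comp continuous_snd)
    · obtain ⟨C, hC⟩ := hF.2 a
      obtain ⟨C', hC'⟩ := h2 l a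
      refine ⟨C * C', fun x q => ?_⟩
      have e1 := hC x Fin.elim0
      have e2 := hC' q
      have e3 : (1 + ‖x‖) ^ a * ‖F x Fin.elim0‖ ≤ C := by
        refine le_trans ?_ e1
        gcongr
        exact le_mul_of_one_le_left (norm_nonneg _) (one_le_pow₀ (by simp))
      simp only [fieldProduct, Pi.smul_apply, norm_smul]
      calc _ = ((1 + ‖x‖) ^ a * ‖F x Fin.elim0‖) * ((1 + ‖q‖) ^ a * ‖Ψ l q‖) := by ring
        _ ≤ _ := by
            have : 0 ≤ C := le_trans (by positivity) e3
            gcongr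
    · simp [fieldProduct, h3]
    · simp [fieldProduct, h4 l hl]
  | succ n ih =>
    intro X _ F hF
    exact (ih _ hF.cons).smearedField_nice W hm

lemma smearedField_add {m : ℝ} (hm : 0 < m) (W : RegularRep σ H) {G G' : Mom → FockFun H}
    (hG : NiceFamily fun z : PUnit × Mom => G z.2)
    (hG' : NiceFamily fun z : PUnit × Mom => G' z.2) :
    smearedField m W (fun k => G k + G' k) = smearedField m W G + smearedField m W G' := by
  have hA : annihilationPart m W (fun k => G k + G' k) =
      annihilationPart m W G + annihilationPart m W G' := by
    ext l q
    have h1 := hG.annihilation_integrable W hm PUnit.unit l q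
    have h2 := hG'.annihilation_integrable W hm PUnit.unit l q
    simp only [annihilationPart, Pi.add_apply, map_add]
    rw [integral_add h1 h2, smul_add]
  have hC : creationPart m W (fun k => G k + G' k) =
      creationPart m W G + creationPart m W G' := by
    ext l q
    cases l with
    | zero => simp [creationPart]
    | succ l => simp [creationPart, Finset.sum_add_distrib]
  rw [smearedField, hA, hC, smearedField, smearedField, ← smul_add]
  congr 1
  abel

lemma smearedField_smul {m : ℝ} (W : RegularRep σ H) (c : ℂ) (G : Mom → FockFun H) :
    smearedField m W (fun k => c • G k) = c • smearedField m W G := by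
  have hA : annihilationPart m W (fun k => c • G k) = c • annihilationPart m W G := by
    ext l q
    simp only [annihilationPart, Pi.smul_apply, map_smul]
    rw [integral_smul, smul_comm]
  have hC : creationPart m W (fun k => c • G k) = c • creationPart m W G := by
    ext l q
    cases l with
    | zero => simp [creationPart]
    | succ l =>
      simp only [creationPart, Pi.smul_apply, map_smul]
      rw [← Finset.smul_sum, smul_comm]
  rw [smearedField, hA, hC, smearedField, ← smul_add, smul_comm]

lemma fieldProduct_smul {m : ℝ} (W : RegularRep σ H) (c : ℂ) (Ψ : FockFun H) (n : ℕ) :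
    ∀ F : (Fin n → Mom) → ℂ, fieldProduct m W n F (c • Ψ) = c • fieldProduct m W n F Ψ := by
  induction n with
  | zero => intro F; simp only [fieldProduct]; rw [smul_comm]
  | succ n ih => intro F; simp only [fieldProduct, ih, smearedField_smul]

lemma fieldProduct_add {m : ℝ} (hm : 0 < m) (W : RegularRep σ H) {Ψ Φ : FockFun H}
    (hΨ : Ψ ∈ fockDomain H) (hΦ : Φ ∈ fockDomain H) (n : ℕ) : ∀ {X : Type} [NormedAddCommGroup X]
    (F : X → (Fin n → Mom) → ℂ), NiceSymbol F → ∀ x,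
    fieldProduct m W n (F x) (Ψ + Φ) = fieldProduct m W n (F x) Ψ + fieldProduct m W n (F x) Φ := by
  induction n with
  | zero => intro X _ F _ x; simp only [fieldProduct, smul_add]
  | succ n ih =>
    intro X _ F hF x
    have hx : NiceSymbol fun (_ : PUnit) => F x := by
      refine ⟨(hF.1.comp (continuous_const.prodMk continuous_id : Continuous fun k => (x, k))).comp
        continuous_snd, fun a => ?_⟩
      obtain ⟨C, hC⟩ := hF.2 a
      refine ⟨C, fun y k => le_trans ?_ (hC x k)⟩
      have : ‖y‖ = 0 := by simp [Subsingleton.elim y 0]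
      rw [this]
      gcongr
      simp
    simp only [fieldProduct]
    rw [← smearedField_add hm W (fieldProduct_nice hm W hΨ n _ hx.cons)
      (fieldProduct_nice hm W hΦ n _ hx.cons)]
    congr 1
    ext k : 1
    exact ih _ hx.cons (PUnit.unit, k)

/-- The tuple `(k_i)_{i ∈ N}` in which the labels of `N` are enumerated in increasing order. -/
noncomputable def orderedConfig (N : Finset ℕ) (k : Fin N.card → Mom) : Config N :=
  WithLp.toLp 2 fun j => k ((N.orderIsoOfFin rfl).symm j.1) j.2

lemma niceSymbol_schwartz {N : Finset ℕ} (F : 𝓢(Config N, ℂ)) :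
    NiceSymbol fun (_ : PUnit) (k : Fin N.card → Mom) => F (orderedConfig N k) := by
  have hc : Continuous (orderedConfig N) := by
    refine (PiLp.continuous_toLp 2 _).comp (continuous_pi fun j => ?_)
    fun_prop
  refine ⟨F.continuous.comp (hc.comp continuous_snd), fun a => ?_⟩
  refine ⟨2 ^ a * ((Finset.Iic (a, 0)).sup fun m => SchwartzMap.seminorm ℝ m.1 m.2) F,
    fun x k => ?_⟩
  have hx : ‖x‖ = 0 := by simp [Subsingleton.elim x 0]
  have h := SchwartzMap.one_add_le_sup_seminorm_apply (𝕜 := ℝ) (m := (a, 0)) (k := a)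
    (n := 0) le_rfl le_rfl F (orderedConfig N k)
  rw [norm_iteratedFDeriv_zero] at h
  rw [hx, add_zero, one_pow, one_mul]
  refine le_trans ?_ h
  have : ‖k‖ ≤ ‖orderedConfig N k‖ :=
    (pi_norm_le_iff_of_nonneg (norm_nonneg _)).2 fun i =>
      (pi_norm_le_iff_of_nonneg (norm_nonneg _)).2 fun μ => by
        simpa [orderedConfig] using
          PiLp.norm_apply_le (orderedConfig N k) (N.orderIsoOfFin rfl i, μ)
  gcongr

/-- The regularized product of fields `φ^n_f = ∫ dx φ(q + x_1) ⋯ φ(q + x_n) f(x_1, …, x_n)`, `n = |N|`,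
as an operator on the domain. Products of fields are compositions of operators. -/
noncomputable def phi {m : ℝ} (hm : 0 < m) (W : RegularRep σ H) {N : Finset ℕ}
    (f : 𝓢(Config N, ℂ)) : Module.End ℂ (fockDomain H) where
  toFun Ψ := ⟨fieldProduct m W N.card (fun k => fourierCheck f (orderedConfig N k)) Ψ, by
    have h := fieldProduct_nice hm W Ψ.2 N.card _ (niceSymbol_schwartz (fourierCheck f))
    obtain ⟨L, hL⟩ := h.fin
    refine ⟨fun l => (h.cont l).comp (continuous_const.prodMk continuous_id :
      Continuous fun q => ((PUnit.unit : PUnit), q)), fun l n => ?_, h.symm PUnit.unit, L,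
      hL PUnit.unit⟩
    obtain ⟨C, hC⟩ := h.decay l n
    exact ⟨C, fun q => by simpa using hC 0 q⟩⟩
  map_add' Ψ Φ := Subtype.ext (fieldProduct_add hm W Ψ.2 Φ.2 N.card _
    (niceSymbol_schwartz (fourierCheck f)) PUnit.unit)
  map_smul' c Ψ := Subtype.ext (fieldProduct_smul W c Ψ.1 N.card _)

/-- The quasiplanar Wick product `:φ^n_f: = ∑ (-1)^κ φ^{|U|}_{γ^C(f)}`, the sum being over the
contractions `C` in `N` with quasiplanar connected components, `κ` being the number of these. -/
noncomputable def qpWick {m : ℝ} (hm : 0 < m) (W : RegularRep σ H) {N : Finset ℕ}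
    (f : 𝓢(Config N, ℂ)) : Module.End ℂ (fockDomain H) :=
  ∑ C ∈ qpContractions N, (-1 : ℂ) ^ (components C.arcs).card • phi hm W (C.gamma hm σ f)

end Fields

end QPWick

open QPWick
open scoped SchwartzMap

/-! # The product formula for quasiplanar Wick products

Expanding both sides of the formula in terms of the regularized products `phi`, the left-hand side
becomes a sum over pairs of contractions in `N` and in `M`, the right-hand side a sum over pairs
`(C, D)` of a connecting contraction `C` in `N ∪ M` and a contraction `D` of the labels that `C`
leaves over. Two Fubini arguments in momentum space identify the summands as `phi` of a single
quantum contraction of `f ⊗ g`: `γ^C f ⊗ γ^D g = γ^{C ∪ D} (f ⊗ g)` for contractions in `N` and in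
`M` (`Contraction.fourierCheck_gamma_union`), and `γ^D ∘ γ^C = γ^{C ∪ D}` if `C` is quasiplanar
(`Contraction.fourierCheck_gamma_gamma`), since then no arc of `D` crosses an arc of `C`.
Composition of operators gives `phi f * phi g = phi (f ⊗ g)` (`phi_mul_phi`).

What remains is combinatorial (`sum_connecting_join`). Fix a contraction `E` in `N ∪ M`. The
summands on the right-hand side with `C ∪ D = E` correspond to the sets `D` of connected components
of `E` that contain every component without an arc from `N` to `M` and consist of components that
are maximal with respect to nesting (`admissible_iff`); each such set has the sign `(-1) ^ κ_D`. If
`E` has an arc from `N` to `M`, then the component of the outermost arc of this kind is maximal and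
may be added to or removed from `D` (`Admissible.symmDiff_component`), so the signs add up to zero.
If `E` has no such arc, only `D = E` is left, and `E` is a union of contractions in `N` and in `M`.
-/

namespace QPWick

open MeasureTheory SchwartzMap Real
open scoped RealInnerProductSpace

/-! ### Crossing classes of arcs -/

/-- Two arcs are linked in `K` if they are joined by a chain of crossings of arcs of `K`; the
connected component of `c ∈ K` consists of the arcs of `K` linked to `c`. -/
def Linked (K : Finset (ℕ × ℕ)) : ℕ × ℕ → ℕ × ℕ → Prop :=
  Relation.EqvGen fun x y => x ∈ K ∧ y ∈ K ∧ Crosses x y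

/-- `D` contains, with an arc of `E`, all the arcs of `E` that cross it: `D ∩ E` is a union of
connected components of `E`. -/
def CrossClosed (E D : Finset (ℕ × ℕ)) : Prop :=
  ∀ c ∈ E, ∀ d ∈ E, Crosses c d → (c ∈ D ↔ d ∈ D)

/-- The arc `c` passes over the arc `d`. -/
def Covers (c d : ℕ × ℕ) : Prop := c.1 < d.1 ∧ d.2 < c.2

lemma Linked.refl (K : Finset (ℕ × ℕ)) (c : ℕ × ℕ) : Linked K c c := Relation.EqvGen.refl c

lemma Linked.symm {K : Finset (ℕ × ℕ)} {c d : ℕ × ℕ} (h : Linked K c d) : Linked K d c :=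
  Relation.EqvGen.symm _ _ h

lemma Linked.trans {K : Finset (ℕ × ℕ)} {c d e : ℕ × ℕ} (h : Linked K c d) (h' : Linked K d e) :
    Linked K c e :=
  Relation.EqvGen.trans _ _ _ h h'

lemma Linked.of_crosses {K : Finset (ℕ × ℕ)} {c d : ℕ × ℕ} (hc : c ∈ K) (hd : d ∈ K)
    (h : Crosses c d) : Linked K c d :=
  Relation.EqvGen.rel _ _ ⟨hc, hd, h⟩

lemma Linked.mono {K L : Finset (ℕ × ℕ)} (hKL : K ⊆ L) {c d : ℕ × ℕ} (h : Linked K c d) :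
    Linked L c d :=
  Relation.EqvGen.mono (fun _ _ h => ⟨hKL h.1, hKL h.2.1, h.2.2⟩) _ _ h

lemma mem_component {K : Finset (ℕ × ℕ)} {c d : ℕ × ℕ} :
    d ∈ component K c ↔ d ∈ K ∧ Linked K c d := by
  simp [component, Linked]

lemma self_mem_component {K : Finset (ℕ × ℕ)} {c : ℕ × ℕ} (hc : c ∈ K) : c ∈ component K c :=
  mem_component.2 ⟨hc, .refl K c⟩

lemma component_subset (K : Finset (ℕ × ℕ)) (c : ℕ × ℕ) : component K c ⊆ K :=
  fun _ h => (mem_component.1 h).1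

lemma Linked.component_eq {K : Finset (ℕ × ℕ)} {c d : ℕ × ℕ} (h : Linked K c d) :
    component K c = component K d := by
  ext e
  rw [mem_component, mem_component]
  exact and_congr_right fun _ => ⟨h.symm.trans, h.trans⟩

lemma components_eq_image (K : Finset (ℕ × ℕ)) : components K = K.image (component K) := by
  classical
  unfold components
  congr!

lemma mem_components {K L : Finset (ℕ × ℕ)} : L ∈ components K ↔ ∃ c ∈ K, component K c = L := by
  simp [components_eq_image]

lemma crossClosed_component (E : Finset (ℕ × ℕ)) (e : ℕ × ℕ) : CrossClosed E (component E e) := by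
  intro c hc d hd h
  have hl := Linked.of_crosses hc hd h
  simp only [mem_component, hc, hd, true_and]
  exact ⟨fun h => h.trans hl, fun h => h.trans hl.symm⟩

lemma CrossClosed.sdiff {E D : Finset (ℕ × ℕ)} (h : CrossClosed E D) : CrossClosed E (E \ D) := by
  intro c hc d hd hcd
  simp [hc, hd, h c hc d hd hcd]

lemma CrossClosed.symmDiff {E D D' : Finset (ℕ × ℕ)} (h : CrossClosed E D)
    (h' : CrossClosed E D') : CrossClosed E (symmDiff D D') := by
  intro c hc d hd hcd
  simp [Finset.mem_symmDiff, h c hc d hd hcd, h' c hc d hd hcd]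

lemma CrossClosed.mem_iff {E D : Finset (ℕ × ℕ)} (h : CrossClosed E D) {c d : ℕ × ℕ}
    (hcd : Linked E c d) : c ∈ D ↔ d ∈ D := by
  induction hcd with
  | rel x y hxy => exact h x hxy.1 y hxy.2.1 hxy.2.2
  | refl x => rfl
  | symm x y _ ih => exact ih.symm
  | trans x y z _ _ ih ih' => exact ih.trans ih'

lemma CrossClosed.linked {E D : Finset (ℕ × ℕ)} (h : CrossClosed E D) {c d : ℕ × ℕ}
    (hcd : Linked E c d) : c ∈ D → Linked D c d := by
  induction hcd with
  | rel x y hxy => exact fun hx => .of_crosses hx ((h x hxy.1 y hxy.2.1 hxy.2.2).1 hx) hxy.2.2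
  | refl x => exact fun _ => .refl D x
  | symm x y hxy ih => exact fun hy => (ih ((h.mem_iff hxy).2 hy)).symm
  | trans x y z hxy _ ih ih' => exact fun hx => (ih hx).trans (ih' ((h.mem_iff hxy).1 hx))

lemma CrossClosed.component_eq {E D : Finset (ℕ × ℕ)} (h : CrossClosed E D) (hD : D ⊆ E)
    {c : ℕ × ℕ} (hc : c ∈ D) : component D c = component E c := by
  ext d
  rw [mem_component, mem_component]
  exact ⟨fun hd => ⟨hD hd.1, hd.2.mono hD⟩, fun hd => ⟨(h.mem_iff hd.2).1 hc, h.linked hd.2 hc⟩⟩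

lemma CrossClosed.components_eq {E D : Finset (ℕ × ℕ)} (h : CrossClosed E D) (hD : D ⊆ E) :
    components D = D.image (component E) := by
  rw [components_eq_image]
  exact Finset.image_congr fun c hc => h.component_eq hD hc

/-- The number of connected components is additive for unions of arcs without mutual crossings. -/
lemma card_components_union {D D' : Finset (ℕ × ℕ)} (hd : Disjoint D D')
    (h : CrossClosed (D ∪ D') D) :
    (components (D ∪ D')).card = (components D).card + (components D').card := by
  have h' : CrossClosed (D ∪ D') D' := by
    have := h.sdiff
    rwa [Finset.union_sdiff_cancel_left hd] at this
  rw [components_eq_image (D ∪ D'), h.components_eq Finset.subset_union_left,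
    h'.components_eq Finset.subset_union_right, Finset.image_union, Finset.card_union_of_disjoint]
  rw [Finset.disjoint_left]
  simp only [Finset.mem_image, not_exists, not_and, forall_exists_index, and_imp]
  rintro K c hc rfl c' hc' he
  have : c ∈ component (D ∪ D') c' := he ▸ self_mem_component (Finset.mem_union_left _ hc)
  exact Finset.disjoint_left.1 hd hc ((h'.mem_iff (mem_component.1 this).2).1 hc')

/-- Adding or removing a connected component changes the parity of the number of components. -/
lemma neg_one_pow_components_symmDiff {E D : Finset (ℕ × ℕ)} (hD : D ⊆ E) (h : CrossClosed E D)
    {e : ℕ × ℕ} (he : e ∈ E) :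
    (-1 : ℂ) ^ (components (symmDiff D (component E e))).card =
      -(-1 : ℂ) ^ (components D).card := by
  set K := component E e with hK
  have hKE : K ⊆ E := component_subset E e
  have hKc : CrossClosed E K := crossClosed_component E e
  have h1 : (components K).card = 1 := by
    rw [hKc.components_eq hKE, Finset.card_eq_one]
    refine ⟨K, Finset.eq_singleton_iff_unique_mem.2 ⟨Finset.mem_image.2
      ⟨e, self_mem_component he, rfl⟩, fun L hL => ?_⟩⟩
    obtain ⟨c, hc, rfl⟩ := Finset.mem_image.1 hL
    exact (mem_component.1 hc).2.component_eq.symm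
  have key : ∀ D' ⊆ E, CrossClosed E D' → Disjoint D' K →
      (components (D' ∪ K)).card = (components D').card + 1 := by
    intro D' hD' hc hd
    rw [card_components_union hd, h1]
    exact fun c h d h' => hc c (Finset.union_subset hD' hKE h) d (Finset.union_subset hD' hKE h')
  by_cases heD : e ∈ D
  · have hKD : K ⊆ D := fun c hc => (h.mem_iff (mem_component.1 hc).2).1 heD
    have h2 : symmDiff D K = D \ K := by
      ext c; simp only [Finset.mem_symmDiff, Finset.mem_sdiff]
      exact or_iff_left fun hc => hc.2 (hKD hc.1)
    have h3 := key (D \ K) (Finset.sdiff_subset.trans hD) (h2 ▸ h.symmDiff hKc)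
      Finset.sdiff_disjoint
    rw [Finset.sdiff_union_of_subset hKD] at h3
    rw [h2, h3, pow_succ]
    ring
  · have hKD : Disjoint D K := by
      rw [Finset.disjoint_left]
      exact fun c hc hc' => heD ((h.mem_iff (mem_component.1 hc').2).2 hc)
    rw [hKD.symmDiff_eq_sup, Finset.sup_eq_union, key D hD h hKD, pow_succ]
    ring

section Contraction

variable {X : Finset ℕ} {E : Contraction X}

lemma mem_endpoints {K : Finset (ℕ × ℕ)} {u : ℕ} :
    u ∈ endpoints K ↔ ∃ c ∈ K, c.1 = u ∨ c.2 = u := by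
  simp only [endpoints, Finset.mem_union, Finset.mem_image]
  constructor
  · rintro (⟨c, hc, h⟩ | ⟨c, hc, h⟩)
    exacts [⟨c, hc, .inl h⟩, ⟨c, hc, .inr h⟩]
  · rintro ⟨c, hc, h | h⟩
    exacts [.inl ⟨c, hc, h⟩, .inr ⟨c, hc, h⟩]

lemma endpoints_union (K L : Finset (ℕ × ℕ)) :
    endpoints (K ∪ L) = endpoints K ∪ endpoints L := by
  ext u
  simp only [mem_endpoints, Finset.mem_union]
  grind

lemma endpoints_mono {K L : Finset (ℕ × ℕ)} (h : K ⊆ L) : endpoints K ⊆ endpoints L := by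
  intro u
  simp only [mem_endpoints]
  exact fun ⟨c, hc, hu⟩ => ⟨c, h hc, hu⟩

lemma Contraction.eq_of_endpoint {c d : ℕ × ℕ} (hc : c ∈ E.arcs) (hd : d ∈ E.arcs) {u : ℕ}
    (hcu : c.1 = u ∨ c.2 = u) (hdu : d.1 = u ∨ d.2 = u) : c = d := by
  by_contra h
  have h1 := E.disjoint c hc d hd h
  have h2 := E.disjoint d hd c hc (Ne.symm h)
  omega

/-- The endpoints of an arc of `E` avoid those of a set of other arcs of `E`. -/
lemma Contraction.endpoint_mem_iff {K : Finset (ℕ × ℕ)} (hK : K ⊆ E.arcs) {d : ℕ × ℕ}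
    (hd : d ∈ E.arcs) {u : ℕ} (hu : d.1 = u ∨ d.2 = u) : u ∈ endpoints K ↔ d ∈ K := by
  rw [mem_endpoints]
  exact ⟨fun ⟨c, hc, hcu⟩ => E.eq_of_endpoint (hK hc) hd hcu hu ▸ hc, fun h => ⟨d, h, hu⟩⟩

/-- An arc that encloses an endpoint of another arc either crosses it or passes over it. -/
lemma Contraction.covers_of_encloses {c d : ℕ × ℕ} (hc : c ∈ E.arcs) (hd : d ∈ E.arcs) {u : ℕ}
    (hu : d.1 = u ∨ d.2 = u) (h : Encloses c u) (h1 : ¬ Crosses c d) (h2 : ¬ Crosses d c) :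
    Covers c d := by
  unfold Encloses Crosses Covers at *
  have hcd : c ≠ d := by rintro rfl; omega
  have h3 := E.disjoint c hc d hd hcd
  have h4 := E.disjoint d hd c hc (Ne.symm hcd)
  have h5 := E.mem_and_lt d hd
  have h6 := E.mem_and_lt c hc
  omega

/-- An arc passes over all of a connected component other than its own, or over none of it. -/
lemma Contraction.covers_iff_of_linked {c d d' : ℕ × ℕ} (hc : c ∈ E.arcs)
    (hdd : Linked E.arcs d d') : ¬ Linked E.arcs c d → (Covers c d ↔ Covers c d') := by
  induction hdd with
  | rel x y h =>
    obtain ⟨hx, hy, hxy⟩ := h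
    intro hn
    have hn' : ¬ Linked E.arcs c y := fun h => hn (h.trans (Linked.of_crosses hx hy hxy).symm)
    have hcx : c ≠ x := by rintro rfl; exact hn (.refl _ _)
    have hcy : c ≠ y := by rintro rfl; exact hn' (.refl _ _)
    have h1 := E.disjoint c hc x hx hcx
    have h2 := E.disjoint c hc y hy hcy
    have h3 := E.disjoint x hx c hc hcx.symm
    have h4 := E.disjoint y hy c hc hcy.symm
    have h5 : ¬ Crosses c x := fun h => hn (.of_crosses hc hx h)
    have h6 : ¬ Crosses x c := fun h => hn (Linked.of_crosses hx hc h).symm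
    have h7 : ¬ Crosses c y := fun h => hn' (.of_crosses hc hy h)
    have h8 : ¬ Crosses y c := fun h => hn' (Linked.of_crosses hy hc h).symm
    unfold Crosses Covers at *
    omega
  | refl x => exact fun _ => Iff.rfl
  | symm x y h ih => exact fun hn => (ih fun h' => hn (h'.trans h)).symm
  | trans x y z h _ ih ih' =>
    exact fun hn => (ih hn).trans (ih' fun h' => hn (h'.trans (Linked.symm h)))

/-- The contraction with a subset of the arcs. -/
def Contraction.restrict (E : Contraction X) (D : Finset (ℕ × ℕ)) (hD : D ⊆ E.arcs) : Contraction X where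
  arcs := D
  mem_and_lt c hc := E.mem_and_lt c (hD hc)
  disjoint c hc d hd := E.disjoint c (hD hc) d (hD hd)

/-- The contraction obtained by contracting, after `C`, further labels left over by `C`. -/
def Contraction.join (C : Contraction X) (D : Contraction C.uncontracted) : Contraction X where
  arcs := C.arcs ∪ D.arcs
  mem_and_lt c hc := by
    rcases Finset.mem_union.1 hc with hc | hc
    · exact C.mem_and_lt c hc
    · have h := D.mem_and_lt c hc
      exact ⟨(Finset.mem_sdiff.1 h.1).1, (Finset.mem_sdiff.1 h.2.1).1, h.2.2⟩
  disjoint c hc d hd hcd := by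
    have key : ∀ c ∈ C.arcs, ∀ d ∈ D.arcs, c.1 ≠ d.1 ∧ c.2 ≠ d.2 ∧ c.1 ≠ d.2 ∧ d.1 ≠ c.2 := by
      intro c hc d hd
      have h := D.mem_and_lt d hd
      have h1 := (Finset.mem_sdiff.1 h.1).2
      have h2 := (Finset.mem_sdiff.1 h.2.1).2
      simp only [mem_endpoints, not_exists, not_and, not_or] at h1 h2
      have h3 := h1 c hc
      have h4 := h2 c hc
      tauto
    rcases Finset.mem_union.1 hc with hc | hc <;> rcases Finset.mem_union.1 hd with hd | hd
    · exact C.disjoint c hc d hd hcd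
    · have := key c hc d hd; tauto
    · have := key d hd c hc; omega
    · exact D.disjoint c hc d hd hcd

lemma Contraction.disjoint_arcs_join {C : Contraction X} (D : Contraction C.uncontracted) :
    Disjoint C.arcs D.arcs := by
  rw [Finset.disjoint_left]
  intro c hc hd
  exact (Finset.mem_sdiff.1 (D.mem_and_lt c hd).1).2 (mem_endpoints.2 ⟨c, hc, .inl rfl⟩)

lemma Contraction.uncontracted_join {C : Contraction X} (D : Contraction C.uncontracted) :
    (C.join D).uncontracted = D.uncontracted := by
  simp only [uncontracted, join, endpoints_union, sdiff_sdiff_left, Finset.sup_eq_union]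

/-- The union of contractions in `N` and in `M`. -/
def Contraction.union {N M : Finset ℕ} (hNM : Disjoint N M) (C : Contraction N)
    (D : Contraction M) : Contraction (N ∪ M) where
  arcs := C.arcs ∪ D.arcs
  mem_and_lt c hc := by
    rcases Finset.mem_union.1 hc with hc | hc
    · have h := C.mem_and_lt c hc
      exact ⟨Finset.mem_union_left _ h.1, Finset.mem_union_left _ h.2.1, h.2.2⟩
    · have h := D.mem_and_lt c hc
      exact ⟨Finset.mem_union_right _ h.1, Finset.mem_union_right _ h.2.1, h.2.2⟩
  disjoint c hc d hd hcd := by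
    rw [Finset.disjoint_left] at hNM
    rcases Finset.mem_union.1 hc with hc | hc <;> rcases Finset.mem_union.1 hd with hd | hd
    · exact C.disjoint c hc d hd hcd
    · have h1 := C.mem_and_lt c hc
      have h2 := D.mem_and_lt d hd
      exact ⟨fun h => hNM h1.1 (h ▸ h2.1), fun h => hNM h1.2.1 (h ▸ h2.2.1),
        fun h => hNM h1.1 (h ▸ h2.2.1)⟩
    · have h1 := D.mem_and_lt c hc
      have h2 := C.mem_and_lt d hd
      exact ⟨fun h => hNM h2.1 (h ▸ h1.1), fun h => hNM h2.2.1 (h ▸ h1.2.1),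
        fun h => hNM h2.2.1 (h ▸ h1.1)⟩
    · exact D.disjoint c hc d hd hcd

end Contraction

/-! ### Splitting a contraction into a connecting part and a rest -/

section Split

variable {N M : Finset ℕ}

/-- The splitting of the arcs `E` into `E \ D` and `D` occurs in the expansion of the right-hand
side: `E \ D` is a connecting contraction in `N ⊔ M`, and the components of `D` are quasiplanar
contractions in the labels left over by `E \ D`. -/
def Admissible (N M : Finset ℕ) (E D : Finset (ℕ × ℕ)) : Prop :=
  Quasiplanar (N ∪ M) (E \ D) ∧ (∀ K ∈ components (E \ D), ∃ c ∈ K, c.1 ∈ N ∧ c.2 ∈ M) ∧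
    ∀ K ∈ components D, Quasiplanar ((N ∪ M) \ endpoints (E \ D)) K

/-- The splittings of `E` that occur are those for which `D` is a union of components of `E` that
are maximal for nesting and comprise all components without an arc from `N` to `M`, provided that
`E` is quasiplanar; otherwise there is none. -/
lemma admissible_iff (E : Contraction (N ∪ M)) {D : Finset (ℕ × ℕ)} (hD : D ⊆ E.arcs) :
    Admissible N M E.arcs D ↔ CrossClosed E.arcs D ∧ Quasiplanar (N ∪ M) E.arcs ∧
      (∀ c ∈ E.arcs, c ∉ D → ∃ d ∈ component E.arcs c, d.1 ∈ N ∧ d.2 ∈ M) ∧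
      ∀ d ∈ D, ∀ c ∈ E.arcs, Covers c d → Linked E.arcs c d := by
  have hED : E.arcs \ D ⊆ E.arcs := Finset.sdiff_subset
  have hmem : ∀ d ∈ E.arcs, ∀ u, (d.1 = u ∨ d.2 = u) → u ∈ N ∪ M := by
    rintro d hd u (rfl | rfl)
    exacts [(E.mem_and_lt d hd).1, (E.mem_and_lt d hd).2.1]
  -- endpoints of arcs of `D` are left over by `E \ D`
  have hleft : ∀ d ∈ D, ∀ u, (d.1 = u ∨ d.2 = u) → u ∈ (N ∪ M) \ endpoints (E.arcs \ D) := by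
    intro d hd u hu
    rw [Finset.mem_sdiff, E.endpoint_mem_iff hED (hD hd) hu]
    exact ⟨hmem d (hD hd) u hu, fun h => (Finset.mem_sdiff.1 h).2 hd⟩
  have hright : ∀ u ∈ (N ∪ M) \ endpoints (E.arcs \ D), u ∈ endpoints E.arcs →
      ∃ d ∈ D, d.1 = u ∨ d.2 = u := by
    intro u hu hu'
    obtain ⟨d, hd, hdu⟩ := mem_endpoints.1 hu'
    refine ⟨d, ?_, hdu⟩
    by_contra h
    exact (Finset.mem_sdiff.1 hu).2 (mem_endpoints.2 ⟨d, Finset.mem_sdiff.2 ⟨hd, h⟩, hdu⟩)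
  constructor
  · rintro ⟨h1, h2, h3⟩
    have hcl : CrossClosed E.arcs D := by
      intro c hc d hd hcd
      by_contra hne
      by_cases hcD : c ∈ D
      · have hdD : d ∉ D := fun h => hne (by simp [hcD, h])
        exact h1 d (Finset.mem_sdiff.2 ⟨hd, hdD⟩) c.2 (hleft c hcD _ (.inr rfl)) ⟨hcd.2.1, hcd.2.2⟩
      · have hdD : d ∈ D := by by_contra h; exact hne (by simp [hcD, h])
        exact h1 c (Finset.mem_sdiff.2 ⟨hc, hcD⟩) d.1 (hleft d hdD _ (.inl rfl)) ⟨hcd.1, hcd.2.1⟩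
    refine ⟨hcl, ?_, ?_, ?_⟩
    · intro c hc u hu
      obtain ⟨hu1, hu2⟩ := Finset.mem_sdiff.1 hu
      have hu3 : u ∈ (N ∪ M) \ endpoints (E.arcs \ D) :=
        Finset.mem_sdiff.2 ⟨hu1, fun h => hu2 (endpoints_mono hED h)⟩
      by_cases hcD : c ∈ D
      · refine h3 _ (mem_components.2 ⟨c, hcD, rfl⟩) c (self_mem_component hcD) u
          (Finset.mem_sdiff.2 ⟨hu3, fun h => hu2 ?_⟩)
        exact endpoints_mono ((component_subset _ _).trans hD) h
      · exact h1 c (Finset.mem_sdiff.2 ⟨hc, hcD⟩) u hu3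
    · intro c hc hcD
      have hc' := Finset.mem_sdiff.2 ⟨hc, hcD⟩
      rw [← hcl.sdiff.component_eq hED hc']
      exact h2 _ (mem_components.2 ⟨c, hc', rfl⟩)
    · intro d hd c hc hcd
      have hdlt := (E.mem_and_lt d (hD hd)).2.2
      have henc : Encloses c d.1 := ⟨hcd.1, hdlt.trans hcd.2⟩
      by_cases hcD : c ∈ D
      · by_contra hl
        refine h3 _ (mem_components.2 ⟨c, hcD, rfl⟩) c (self_mem_component hcD) d.1
          (Finset.mem_sdiff.2 ⟨hleft d hd _ (.inl rfl), fun h => hl ?_⟩) henc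
        rw [E.endpoint_mem_iff ((component_subset _ _).trans hD) (hD hd) (.inl rfl)] at h
        exact (mem_component.1 h).2.mono hD
      · exact absurd henc (h1 c (Finset.mem_sdiff.2 ⟨hc, hcD⟩) d.1 (hleft d hd _ (.inl rfl)))
  · rintro ⟨hcl, hqp, hcon, hmax⟩
    -- if `c` encloses an endpoint of `d ∈ D`, then it is linked to `d`
    have key : ∀ c ∈ E.arcs, ∀ d ∈ D, ∀ u, (d.1 = u ∨ d.2 = u) → Encloses c u →
        Linked E.arcs c d := by
      intro c hc d hd u hu henc
      by_cases h1 : Crosses c d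
      · exact .of_crosses hc (hD hd) h1
      by_cases h2 : Crosses d c
      · exact (Linked.of_crosses (hD hd) hc h2).symm
      exact hmax d hd c hc (E.covers_of_encloses hc (hD hd) hu henc h1 h2)
    refine ⟨?_, ?_, ?_⟩
    · intro c hc u hu henc
      obtain ⟨hc, hcD⟩ := Finset.mem_sdiff.1 hc
      by_cases hue : u ∈ endpoints E.arcs
      · obtain ⟨d, hd, hdu⟩ := hright u hu hue
        exact hcD ((hcl.mem_iff (key c hc d hd u hdu henc)).2 hd)
      · exact hqp c hc u (Finset.mem_sdiff.2 ⟨(Finset.mem_sdiff.1 hu).1, hue⟩) henc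
    · intro K hK
      obtain ⟨c, hc, rfl⟩ := mem_components.1 hK
      rw [hcl.sdiff.component_eq hED hc]
      exact hcon c (Finset.mem_sdiff.1 hc).1 (Finset.mem_sdiff.1 hc).2
    · intro K hK
      obtain ⟨c, hc, rfl⟩ := mem_components.1 hK
      intro c' hc' u hu henc
      obtain ⟨hu, huK⟩ := Finset.mem_sdiff.1 hu
      have hc'D := component_subset _ _ hc'
      by_cases hue : u ∈ endpoints E.arcs
      · obtain ⟨d, hd, hdu⟩ := hright u hu hue
        have hl := key c' (hD hc'D) d hd u hdu henc
        refine huK (mem_endpoints.2 ⟨d, mem_component.2 ⟨hd, ?_⟩, hdu⟩)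
        exact (mem_component.1 hc').2.trans (hcl.linked hl hc'D)
      · exact hqp c' (hD hc'D) u (Finset.mem_sdiff.2 ⟨(Finset.mem_sdiff.1 hu).1, hue⟩) henc

/-- If `E` has an arc from `N` to `M`, then the component of the outermost such arc (the one with
the smallest starting label) may be moved between the two parts of an admissible splitting: it has
an arc from `N` to `M`, and it is maximal for nesting because every arc passing over an arc from
`N` to `M` is itself such an arc. -/
lemma Admissible.symmDiff_component (hNM : ∀ i ∈ N, ∀ j ∈ M, i < j) {E : Contraction (N ∪ M)}
    {D : Finset (ℕ × ℕ)} (hD : D ⊆ E.arcs) (h : Admissible N M E.arcs D) {e : ℕ × ℕ}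
    (he : e ∈ E.arcs) (heN : e.1 ∈ N) (heM : e.2 ∈ M)
    (hmin : ∀ c ∈ E.arcs, c.1 ∈ N → c.2 ∈ M → e.1 ≤ c.1) :
    Admissible N M E.arcs (symmDiff D (component E.arcs e)) := by
  have hK := component_subset E.arcs e
  have hD' : symmDiff D (component E.arcs e) ⊆ E.arcs := fun c hc => by
    rcases Finset.mem_symmDiff.1 hc with hc | hc
    exacts [hD hc.1, hK hc.1]
  obtain ⟨hcl, hqp, hcon, hmax⟩ := (admissible_iff E hD).1 h
  refine (admissible_iff E hD').2 ⟨hcl.symmDiff (crossClosed_component _ _), hqp, ?_, ?_⟩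
  · intro c hc hcD
    by_cases hcK : c ∈ component E.arcs e
    · exact ⟨e, mem_component.2 ⟨he, (mem_component.1 hcK).2.symm⟩, heN, heM⟩
    · exact hcon c hc fun h => hcD (Finset.mem_symmDiff.2 (.inl ⟨h, hcK⟩))
  · intro d hd c hc hcd
    rcases Finset.mem_symmDiff.1 hd with hd | hd
    · exact hmax d hd.1 c hc hcd
    · by_contra hl
      have hce := (E.covers_iff_of_linked hc (mem_component.1 hd.1).2.symm hl).1 hcd
      obtain ⟨h1, h2, h3⟩ := E.mem_and_lt c hc
      have hcN : c.1 ∈ N := (Finset.mem_union.1 h1).resolve_right fun h =>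
        absurd (hNM _ heN _ h) (not_lt.2 hce.1.le)
      have hcM : c.2 ∈ M := (Finset.mem_union.1 h2).resolve_left fun h =>
        absurd (hNM _ h _ heM) (not_lt.2 hce.2.le)
      exact absurd (hmin c hc hcN hcM) (not_le.2 hce.1)

open Classical in
/-- The splittings of contractions in `N ⊔ M` that occur on the right-hand side. -/
noncomputable def splittings (N M : Finset ℕ) :
    Finset (Contraction (N ∪ M) × Finset (ℕ × ℕ)) :=
  (Finset.univ ×ˢ ((N ∪ M) ×ˢ (N ∪ M)).powerset).filter fun z =>
    z.2 ⊆ z.1.arcs ∧ Admissible N M z.1.arcs z.2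

lemma mem_splittings {z : Contraction (N ∪ M) × Finset (ℕ × ℕ)} :
    z ∈ splittings N M ↔ z.2 ⊆ z.1.arcs ∧ Admissible N M z.1.arcs z.2 := by
  simp only [splittings, Finset.mem_filter, Finset.mem_product, Finset.mem_univ, true_and,
    Finset.mem_powerset, and_iff_right_iff_imp]
  intro h c hc
  have := z.1.mem_and_lt c (h.1 hc)
  exact Finset.mem_product.2 ⟨this.1, this.2.1⟩

lemma mem_qpContractions {C : Contraction N} :
    C ∈ qpContractions N ↔ ∀ K ∈ components C.arcs, Quasiplanar N K := by
  simp [qpContractions]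

lemma mem_connectingContractions {C : Contraction (N ∪ M)} :
    C ∈ connectingContractions N M ↔ Quasiplanar (N ∪ M) C.arcs ∧
      ∀ K ∈ components C.arcs, ∃ c ∈ K, c.1 ∈ N ∧ c.2 ∈ M := by
  simp [connectingContractions]

variable {V : Type*} [AddCommGroup V] [Module ℂ V]

lemma sum_connecting_eq_sum_splittings (Φ : Contraction (N ∪ M) → V) :
    ∑ C ∈ connectingContractions N M, ∑ D ∈ qpContractions C.uncontracted,
      (-1 : ℂ) ^ (components D.arcs).card • Φ (C.join D) =
    ∑ z ∈ splittings N M, (-1 : ℂ) ^ (components z.2).card • Φ z.1 := by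
  classical
  have hsd : ∀ (C : Contraction (N ∪ M)) (D : Contraction C.uncontracted),
      (C.join D).arcs \ D.arcs = C.arcs := fun C D =>
    Finset.union_sdiff_cancel_right (Contraction.disjoint_arcs_join D)
  rw [Finset.sum_sigma']
  refine Finset.sum_bij (fun x _ => (x.1.join x.2, x.2.arcs)) ?_ ?_ ?_ ?_
  · rintro ⟨C, D⟩ h
    rw [Finset.mem_sigma, mem_connectingContractions, mem_qpContractions] at h
    refine mem_splittings.2 ⟨Finset.subset_union_right, ?_⟩
    dsimp only at h ⊢
    rw [Admissible, hsd]
    exact ⟨h.1.1, h.1.2, h.2⟩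
  · rintro ⟨C, D⟩ _ ⟨C', D'⟩ _ h
    obtain ⟨h1, h2⟩ := Prod.mk.inj h
    dsimp only at h1 h2
    obtain rfl : C = C' := Contraction.ext (by rw [← hsd C D, ← hsd C' D', h1, h2])
    obtain rfl : D = D' := Contraction.ext h2
    rfl
  · rintro ⟨E, D⟩ h
    obtain ⟨hD, h1, h2, h3⟩ := mem_splittings.1 h
    dsimp only at hD h1 h2 h3
    let C : Contraction (N ∪ M) := E.restrict (E.arcs \ D) Finset.sdiff_subset
    let D' : Contraction C.uncontracted :=
      { arcs := D
        mem_and_lt := fun c hc => by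
          have h := E.mem_and_lt c (hD hc)
          have h' : c ∉ E.arcs \ D := fun h => (Finset.mem_sdiff.1 h).2 hc
          refine ⟨Finset.mem_sdiff.2 ⟨h.1, fun hu => h' ?_⟩,
            Finset.mem_sdiff.2 ⟨h.2.1, fun hu => h' ?_⟩, h.2.2⟩
          · exact (E.endpoint_mem_iff Finset.sdiff_subset (hD hc) (.inl rfl)).1 hu
          · exact (E.endpoint_mem_iff Finset.sdiff_subset (hD hc) (.inr rfl)).1 hu
        disjoint := fun c hc d hd => E.disjoint c (hD hc) d (hD hd) }
    refine ⟨⟨C, D'⟩, Finset.mem_sigma.2 ⟨mem_connectingContractions.2 ⟨h1, h2⟩,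
      mem_qpContractions.2 h3⟩, Prod.ext (Contraction.ext ?_) rfl⟩
    exact Finset.sdiff_union_of_subset hD
  · rintro ⟨C, D⟩ _
    rfl

/-- The contractions with an arc from `N` to `M` cancel among the splittings. -/
lemma sum_splittings_connected (hNM : ∀ i ∈ N, ∀ j ∈ M, i < j) (Φ : Contraction (N ∪ M) → V) :
    ∑ z ∈ splittings N M with ∃ c ∈ z.1.arcs, c.1 ∈ N ∧ c.2 ∈ M,
      (-1 : ℂ) ^ (components z.2).card • Φ z.1 = 0 := by
  classical
  have hex : ∀ E : Contraction (N ∪ M), (∃ c ∈ E.arcs, c.1 ∈ N ∧ c.2 ∈ M) →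
      ∃ e ∈ E.arcs, e.1 ∈ N ∧ e.2 ∈ M ∧ ∀ c ∈ E.arcs, c.1 ∈ N → c.2 ∈ M → e.1 ≤ c.1 := by
    rintro E ⟨c, hc, hcN, hcM⟩
    obtain ⟨e, he, hmin⟩ := (E.arcs.filter fun c => c.1 ∈ N ∧ c.2 ∈ M).exists_min_image
      Prod.fst ⟨c, Finset.mem_filter.2 ⟨hc, hcN, hcM⟩⟩
    obtain ⟨he, heN, heM⟩ := Finset.mem_filter.1 he
    exact ⟨e, he, heN, heM, fun c hc h h' => hmin c (Finset.mem_filter.2 ⟨hc, h, h'⟩)⟩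
  choose! e he heN heM hmin using hex
  refine Finset.sum_involution
    (fun z _ => (z.1, symmDiff z.2 (component z.1.arcs (e z.1)))) ?_ ?_ ?_ ?_
  · rintro ⟨E, D⟩ hz
    obtain ⟨hz, hE⟩ := Finset.mem_filter.1 hz
    obtain ⟨hD, hA⟩ := mem_splittings.1 hz
    dsimp only at hD hA hE ⊢
    rw [neg_one_pow_components_symmDiff hD ((admissible_iff E hD).1 hA).1 (he E hE), neg_smul,
      add_neg_cancel]
  · rintro ⟨E, D⟩ hz _ h
    obtain ⟨hz, hE⟩ := Finset.mem_filter.1 hz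
    have h1 : symmDiff D (component E.arcs (e E)) = D := congrArg Prod.snd h
    rw [symmDiff_eq_left] at h1
    have h2 := self_mem_component (he E hE)
    rw [h1] at h2
    simp at h2
  · rintro ⟨E, D⟩ hz
    obtain ⟨hz, hE⟩ := Finset.mem_filter.1 hz
    obtain ⟨hD, hA⟩ := mem_splittings.1 hz
    refine Finset.mem_filter.2 ⟨mem_splittings.2 ⟨fun c hc => ?_,
      hA.symmDiff_component hNM hD (he E hE) (heN E hE) (heM E hE) (hmin E hE)⟩, hE⟩
    rcases Finset.mem_symmDiff.1 hc with hc | hc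
    exacts [hD hc.1, component_subset _ _ hc.1]
  · rintro ⟨E, D⟩ _
    simp

lemma quasiplanar_union_left (hNM : ∀ i ∈ N, ∀ j ∈ M, i < j) {K : Finset (ℕ × ℕ)}
    (hK : ∀ c ∈ K, c.2 ∈ N) : Quasiplanar (N ∪ M) K ↔ Quasiplanar N K := by
  refine ⟨fun h c hc u hu => h c hc u ?_, fun h c hc u hu henc => ?_⟩
  · obtain ⟨h1, h2⟩ := Finset.mem_sdiff.1 hu
    exact Finset.mem_sdiff.2 ⟨Finset.mem_union_left _ h1, h2⟩
  · obtain ⟨h1, h2⟩ := Finset.mem_sdiff.1 hu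
    rcases Finset.mem_union.1 h1 with h1 | h1
    · exact h c hc u (Finset.mem_sdiff.2 ⟨h1, h2⟩) henc
    · exact absurd (hNM _ (hK c hc) _ h1) (not_lt.2 henc.2.le)

lemma quasiplanar_union_right (hNM : ∀ i ∈ N, ∀ j ∈ M, i < j) {K : Finset (ℕ × ℕ)}
    (hK : ∀ c ∈ K, c.1 ∈ M) : Quasiplanar (N ∪ M) K ↔ Quasiplanar M K := by
  refine ⟨fun h c hc u hu => h c hc u ?_, fun h c hc u hu henc => ?_⟩
  · obtain ⟨h1, h2⟩ := Finset.mem_sdiff.1 hu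
    exact Finset.mem_sdiff.2 ⟨Finset.mem_union_right _ h1, h2⟩
  · obtain ⟨h1, h2⟩ := Finset.mem_sdiff.1 hu
    rcases Finset.mem_union.1 h1 with h1 | h1
    · exact absurd (hNM _ h1 _ (hK c hc)) (not_lt.2 henc.1.le)
    · exact h c hc u (Finset.mem_sdiff.2 ⟨h1, h2⟩) henc

lemma crossClosed_union (hNM : ∀ i ∈ N, ∀ j ∈ M, i < j) (C : Contraction N) (D : Contraction M) :
    CrossClosed (C.arcs ∪ D.arcs) C.arcs := by
  intro c hc d hd hcd
  rcases Finset.mem_union.1 hc with hc | hc <;> rcases Finset.mem_union.1 hd with hd | hd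
  · simp [hc, hd]
  · exact absurd (hNM _ (C.mem_and_lt c hc).2.1 _ (D.mem_and_lt d hd).1) (not_lt.2 hcd.2.1.le)
  · have h1 := D.mem_and_lt c hc
    have h2 := hNM _ (C.mem_and_lt d hd).1 _ h1.1
    exact absurd h2 (not_lt.2 hcd.1.le)
  · have : ∀ x ∈ D.arcs, x ∉ C.arcs := fun x hx hx' =>
      lt_irrefl _ (hNM _ (C.mem_and_lt x hx').1 _ (D.mem_and_lt x hx).1)
    simp [this c hc, this d hd]

lemma disjoint_of_forall_lt (hNM : ∀ i ∈ N, ∀ j ∈ M, i < j) : Disjoint N M :=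
  Finset.disjoint_left.2 fun i hi hi' => lt_irrefl i (hNM i hi i hi')

lemma Contraction.disjoint_arcs_union (hNM : Disjoint N M) (C : Contraction N)
    (D : Contraction M) : Disjoint C.arcs D.arcs :=
  Finset.disjoint_left.2 fun c hc hc' =>
    Finset.disjoint_left.1 hNM (C.mem_and_lt c hc).1 (D.mem_and_lt c hc').1

/-- The splittings of contractions without an arc from `N` to `M` are trivial, and these
contractions are the unions of contractions in `N` and in `M`. -/
lemma sum_splittings_disconnected (hNM : ∀ i ∈ N, ∀ j ∈ M, i < j) (Φ : Contraction (N ∪ M) → V) :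
    ∑ z ∈ splittings N M with ¬ ∃ c ∈ z.1.arcs, c.1 ∈ N ∧ c.2 ∈ M,
      (-1 : ℂ) ^ (components z.2).card • Φ z.1 =
    ∑ z ∈ qpContractions N ×ˢ qpContractions M,
      (-1 : ℂ) ^ ((components z.1.arcs).card + (components z.2.arcs).card) •
        Φ (z.1.union (disjoint_of_forall_lt hNM) z.2) := by
  classical
  have hdis := disjoint_of_forall_lt hNM
  have hcl := crossClosed_union hNM
  have hcl' : ∀ (C : Contraction N) (D : Contraction M),
      CrossClosed (C.arcs ∪ D.arcs) D.arcs := fun C D => by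
    have := (hcl C D).sdiff
    rwa [Finset.union_sdiff_cancel_left (C.disjoint_arcs_union hdis D)] at this
  have hadm : ∀ (C : Contraction N) (D : Contraction M),
      Admissible N M (C.union hdis D).arcs (C.union hdis D).arcs ↔
        C ∈ qpContractions N ∧ D ∈ qpContractions M := by
    intro C D
    have h0 : components (∅ : Finset (ℕ × ℕ)) = ∅ := by simp [components_eq_image]
    have h1 : components (C.union hdis D).arcs = components C.arcs ∪ components D.arcs := by
      rw [components_eq_image, (hcl C D).components_eq Finset.subset_union_left,
        (hcl' C D).components_eq Finset.subset_union_right, ← Finset.image_union]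
      rfl
    have h2 : ∀ K ∈ components C.arcs, Quasiplanar (N ∪ M) K ↔ Quasiplanar N K := by
      intro K hK
      obtain ⟨c, _, rfl⟩ := mem_components.1 hK
      exact quasiplanar_union_left hNM fun d hd => (C.mem_and_lt d (component_subset _ _ hd)).2.1
    have h3 : ∀ K ∈ components D.arcs, Quasiplanar (N ∪ M) K ↔ Quasiplanar M K := by
      intro K hK
      obtain ⟨c, _, rfl⟩ := mem_components.1 hK
      exact quasiplanar_union_right hNM fun d hd => (D.mem_and_lt d (component_subset _ _ hd)).1
    rw [mem_qpContractions, mem_qpContractions, Admissible, Finset.sdiff_self, h0, h1,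
      ← forall₂_congr h2, ← forall₂_congr h3]
    simp only [endpoints, Finset.image_empty, Finset.union_idempotent, Finset.sdiff_empty,
      Finset.notMem_empty, Finset.mem_union, or_imp, forall_and]
    simp [Quasiplanar]
  symm
  refine Finset.sum_bij (fun z _ => (z.1.union hdis z.2, (z.1.union hdis z.2).arcs)) ?_ ?_ ?_ ?_
  · rintro ⟨C, D⟩ h
    refine Finset.mem_filter.2 ⟨mem_splittings.2 ⟨subset_rfl,
      (hadm C D).2 (Finset.mem_product.1 h)⟩, ?_⟩
    rintro ⟨c, hc, hcN, hcM⟩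
    rcases Finset.mem_union.1 hc with hc | hc
    · exact Finset.disjoint_left.1 hdis (C.mem_and_lt c hc).2.1 hcM
    · exact Finset.disjoint_left.1 hdis hcN (D.mem_and_lt c hc).1
  · rintro ⟨C, D⟩ _ ⟨C', D'⟩ _ h
    have h1 : C.arcs ∪ D.arcs = C'.arcs ∪ D'.arcs := congrArg Prod.snd h
    have key : ∀ (C : Contraction N) (D : Contraction M),
        (C.arcs ∪ D.arcs).filter (fun c => c.1 ∈ N) = C.arcs ∧
        (C.arcs ∪ D.arcs).filter (fun c => c.1 ∈ M) = D.arcs := by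
      intro C D
      have hC := fun c hc => (C.mem_and_lt c hc).1
      have hD := fun c hc => (D.mem_and_lt c hc).1
      rw [Finset.disjoint_left] at hdis
      constructor <;> ext c <;> simp only [Finset.mem_filter, Finset.mem_union] <;> grind
    refine Prod.ext (Contraction.ext ?_) (Contraction.ext ?_)
    · rw [← (key C D).1, ← (key C' D').1, h1]
    · rw [← (key C D).2, ← (key C' D').2, h1]
  · rintro ⟨E, D⟩ hz
    obtain ⟨hz, hE⟩ := Finset.mem_filter.1 hz
    obtain ⟨hD, hA⟩ := mem_splittings.1 hz
    dsimp only at hD hA hE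
    obtain rfl : D = E.arcs := by
      refine hD.antisymm fun c hc => ?_
      by_contra hcD
      obtain ⟨d, hd, h⟩ := ((admissible_iff E hD).1 hA).2.2.1 c hc hcD
      exact hE ⟨d, component_subset _ _ hd, h⟩
    let C₁ : Contraction N :=
      { arcs := E.arcs.filter fun c => c.2 ∈ N
        mem_and_lt := fun c hc => by
          obtain ⟨hc, h⟩ := Finset.mem_filter.1 hc
          obtain ⟨h1, h2, h3⟩ := E.mem_and_lt c hc
          exact ⟨(Finset.mem_union.1 h1).resolve_right fun h' => by
            have := hNM _ h _ h'; omega, h, h3⟩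
        disjoint := fun c hc d hd =>
          E.disjoint c (Finset.mem_filter.1 hc).1 d (Finset.mem_filter.1 hd).1 }
    let C₂ : Contraction M :=
      { arcs := E.arcs.filter fun c => c.1 ∈ M
        mem_and_lt := fun c hc => by
          obtain ⟨hc, h⟩ := Finset.mem_filter.1 hc
          obtain ⟨h1, h2, h3⟩ := E.mem_and_lt c hc
          exact ⟨h, (Finset.mem_union.1 h2).resolve_left fun h' => by
            have := hNM _ h' _ h; omega, h3⟩
        disjoint := fun c hc d hd =>
          E.disjoint c (Finset.mem_filter.1 hc).1 d (Finset.mem_filter.1 hd).1 }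
    have hEq : C₁.union hdis C₂ = E := by
      refine Contraction.ext ?_
      ext c
      simp only [Contraction.union, C₁, C₂, Finset.mem_union, Finset.mem_filter, ← and_or_left,
        and_iff_left_iff_imp]
      intro hc
      obtain ⟨h1, h2, h3⟩ := E.mem_and_lt c hc
      rcases Finset.mem_union.1 h1 with h1 | h1
      · exact .inl ((Finset.mem_union.1 h2).resolve_right fun h => hE ⟨c, hc, h1, h⟩)
      · exact .inr h1
    refine ⟨(C₁, C₂), Finset.mem_product.2 ((hadm C₁ C₂).1 (by rw [hEq]; exact hA)), ?_⟩
    dsimp only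
    rw [hEq]
  · rintro ⟨C, D⟩ _
    dsimp only
    rw [← card_components_union (C.disjoint_arcs_union hdis D) (hcl C D)]
    rfl

/-- The combinatorial content of the product formula: in the sum over all connecting contractions
`C` and all contractions `D` of what is left, everything cancels except for the contractions that
do not connect `N` with `M`. -/
theorem sum_connecting_join (hNM : ∀ i ∈ N, ∀ j ∈ M, i < j) (Φ : Contraction (N ∪ M) → V) :
    ∑ C ∈ connectingContractions N M, ∑ D ∈ qpContractions C.uncontracted,
      (-1 : ℂ) ^ (components D.arcs).card • Φ (C.join D) =
    ∑ C ∈ qpContractions N, ∑ D ∈ qpContractions M,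
      (-1 : ℂ) ^ ((components C.arcs).card + (components D.arcs).card) •
        Φ (C.union (disjoint_of_forall_lt hNM) D) := by
  classical
  rw [sum_connecting_eq_sum_splittings, ← Finset.sum_filter_add_sum_filter_not (splittings N M)
    (fun z => ∃ c ∈ z.1.arcs, c.1 ∈ N ∧ c.2 ∈ M), sum_splittings_connected hNM,
    sum_splittings_disconnected hNM, zero_add, Finset.sum_product]

end Split

/-! ### Splitting integrals over products of finitely many factors -/

/-- The tuple indexed by `ι` with prescribed parts over the summands of `ι₁ ⊕ ι₂ ≃ ι`. -/
def glue {ι₁ ι₂ ι V : Type*} (e : ι₁ ⊕ ι₂ ≃ ι) (p : ι₁ → V) (q : ι₂ → V) : ι → V :=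
  fun i => Sum.elim p q (e.symm i)

lemma glue_inl {ι₁ ι₂ ι V : Type*} (e : ι₁ ⊕ ι₂ ≃ ι) (p : ι₁ → V) (q : ι₂ → V) (a : ι₁) :
    glue e p q (e (.inl a)) = p a := by simp [glue]

lemma glue_inr {ι₁ ι₂ ι V : Type*} (e : ι₁ ⊕ ι₂ ≃ ι) (p : ι₁ → V) (q : ι₂ → V) (b : ι₂) :
    glue e p q (e (.inr b)) = q b := by simp [glue]

lemma exists_measurableEquiv_glue {ι₁ ι₂ ι V : Type} [Fintype ι₁] [Fintype ι₂] [Fintype ι]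
    [MeasurableSpace V] (μ : Measure V) [SigmaFinite μ] (e : ι₁ ⊕ ι₂ ≃ ι) :
    ∃ T : (ι₁ → V) × (ι₂ → V) ≃ᵐ (ι → V), (∀ z, T z = glue e z.1 z.2) ∧
      MeasurePreserving T ((Measure.pi fun _ => μ).prod (Measure.pi fun _ => μ))
        (Measure.pi fun _ => μ) := by
  refine ⟨(MeasurableEquiv.sumPiEquivProdPi fun _ : ι₁ ⊕ ι₂ => V).symm.trans
    (MeasurableEquiv.piCongrLeft (fun _ : ι => V) e), fun z => ?_, ?_⟩
  · ext i
    obtain ⟨j, rfl⟩ := e.surjective i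
    have h := Equiv.piCongrLeft_apply_apply (fun _ : ι => V) e
      ((Equiv.sumPiEquivProdPi fun _ : ι₁ ⊕ ι₂ => V).symm z) j
    refine Eq.trans h ?_
    rcases j with a | b
    · rw [glue_inl]; rfl
    · rw [glue_inr]; rfl
  · exact (measurePreserving_piCongrLeft (fun _ : ι => μ) e).comp
      (measurePreserving_sumPiEquivProdPi fun _ : ι₁ ⊕ ι₂ => μ).symm

lemma integral_glue {ι₁ ι₂ ι V : Type} [Fintype ι₁] [Fintype ι₂] [Fintype ι]
    [MeasurableSpace V] (μ : Measure V) [SigmaFinite μ] (e : ι₁ ⊕ ι₂ ≃ ι) (F : (ι → V) → ℂ) :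
    ∫ x, F x ∂(Measure.pi fun _ => μ) =
      ∫ z, F (glue e z.1 z.2) ∂((Measure.pi fun _ => μ).prod (Measure.pi fun _ => μ)) := by
  obtain ⟨T, hT, hmp⟩ := exists_measurableEquiv_glue μ e
  rw [← hmp.integral_comp' F]
  simp only [hT]

lemma integrable_glue {ι₁ ι₂ ι V : Type} [Fintype ι₁] [Fintype ι₂] [Fintype ι]
    [MeasurableSpace V] (μ : Measure V) [SigmaFinite μ] (e : ι₁ ⊕ ι₂ ≃ ι) {F : (ι → V) → ℂ}
    (hF : Integrable F (Measure.pi fun _ => μ)) :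
    Integrable (fun z : (ι₁ → V) × (ι₂ → V) => F (glue e z.1 z.2))
      ((Measure.pi fun _ => μ).prod (Measure.pi fun _ => μ)) := by
  obtain ⟨T, hT, hmp⟩ := exists_measurableEquiv_glue μ e
  simpa only [Function.comp_def, hT] using (hmp.integrable_comp_emb T.measurableEmbedding).2 hF

lemma sum_eq_sum_inl_add_sum_inr {ι₁ ι₂ ι V : Type*} [Fintype ι₁] [Fintype ι₂] [Fintype ι]
    [AddCommMonoid V] (e : ι₁ ⊕ ι₂ ≃ ι) (F : ι → V) :
    ∑ i, F i = ∑ a, F (e (.inl a)) + ∑ b, F (e (.inr b)) := by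
  rw [← e.sum_comp F, Fintype.sum_sum_type]

/-! ### The transform of a tensor product -/

lemma restrictConfig_apply {N M : Finset ℕ} (h : N ⊆ M) (x : Config M) (i : N) (μ : Fin 4) :
    restrictConfig h x (i, μ) = x (⟨i, h i.2⟩, μ) := rfl

lemma fourierCheck_tensor {N M : Finset ℕ} (hNM : Disjoint N M) (f : 𝓢(Config N, ℂ))
    (g : 𝓢(Config M, ℂ)) (k : Config (N ∪ M)) :
    fourierCheck (tensor f g) k = fourierCheck f (restrictConfig Finset.subset_union_left k) *
      fourierCheck g (restrictConfig Finset.subset_union_right k) := by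
  have hpi : ∀ (N : Finset ℕ) (F : Config N → ℂ),
      ∫ x, F x = ∫ x : N × Fin 4 → ℝ, F (WithLp.toLp 2 x) ∂(Measure.pi fun _ => volume) := by
    intro N F
    exact ((PiLp.volume_preserving_toLp (N × Fin 4)).integral_comp
      (MeasurableEquiv.toLp 2 (N × Fin 4 → ℝ)).measurableEmbedding F).symm
  let e : (N × Fin 4) ⊕ (M × Fin 4) ≃ ↥(N ∪ M) × Fin 4 :=
    (Equiv.sumProdDistrib _ _ _).symm.trans
      ((Equiv.Finset.union N M hNM).prodCongr (Equiv.refl (Fin 4)))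
  have hl : ∀ x y, restrictConfig Finset.subset_union_left (WithLp.toLp 2 (glue e x y)) =
      (WithLp.toLp 2 x : Config N) := by
    intro x y
    ext i
    exact glue_inl e x y i
  have hr : ∀ x y, restrictConfig Finset.subset_union_right (WithLp.toLp 2 (glue e x y)) =
      (WithLp.toLp 2 y : Config M) := by
    intro x y
    ext i
    exact glue_inr e x y i
  have hinner : ∀ x y, ⟪k, WithLp.toLp 2 (glue e x y)⟫ =
      ⟪restrictConfig Finset.subset_union_left k, (WithLp.toLp 2 x : Config N)⟫ +
      ⟪restrictConfig Finset.subset_union_right k, (WithLp.toLp 2 y : Config M)⟫ := by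
    intro x y
    simp only [PiLp.inner_apply]
    rw [sum_eq_sum_inl_add_sum_inr e]
    simp only [glue_inl, glue_inr]
    rfl
  simp only [fourierCheck_apply]
  rw [hpi, hpi, hpi, integral_glue volume e, mul_mul_mul_comm, ← integral_prod_mul,
    Finset.card_union_of_disjoint hNM, mul_add, pow_add, mul_inv]
  congr 2
  ext z
  have ht : ∀ x, tensor f g x = f (restrictConfig Finset.subset_union_left x) *
    g (restrictConfig Finset.subset_union_right x) := fun x => rfl
  rw [ht, hl, hr, hinner, Complex.ofReal_add, mul_add, Complex.exp_add]
  ring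

/-! ### Products of smeared fields -/

section Fields

variable {σ : Matrix (Fin 4) (Fin 4) ℝ} {H : Type*} [NormedAddCommGroup H]
  [InnerProductSpace ℂ H]

lemma fieldProduct_const_mul {m : ℝ} (W : RegularRep σ H) (c : ℂ) (Ψ : FockFun H) (n : ℕ) :
    ∀ F : (Fin n → Mom) → ℂ,
      fieldProduct m W n (fun k => c * F k) Ψ = c • fieldProduct m W n F Ψ := by
  induction n with
  | zero => intro F; simp only [fieldProduct, mul_smul]
  | succ n ih => intro F; simp only [fieldProduct, ih, smearedField_smul]

/-- A composition of products of `n` and `n'` fields is a product of `n + n'` fields. The length `l`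
is a variable in order that it can be the cardinality of a union of label sets. -/
lemma fieldProduct_fieldProduct {m : ℝ} (W : RegularRep σ H) (Ψ : FockFun H) {n' : ℕ}
    (G : (Fin n' → Mom) → ℂ) (n : ℕ) : ∀ (l : ℕ) (h : l = n + n') (F : (Fin n → Mom) → ℂ),
    fieldProduct m W n F (fieldProduct m W n' G Ψ) =
      fieldProduct m W l (fun k => F (fun i => k ⟨i, by omega⟩) *
        G (fun i => k ⟨n + i, by omega⟩)) Ψ := by
  induction n with
  | zero =>
    intro l h F
    obtain rfl : l = n' := by omega
    rw [fieldProduct, ← fieldProduct_const_mul]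
    congr 1
    ext k
    congr 2
    · exact Subsingleton.elim _ _
    · ext i
      simp
  | succ n ih =>
    intro l h F
    obtain ⟨l, rfl⟩ : ∃ l', l = l' + 1 := ⟨n + n', by omega⟩
    simp only [fieldProduct]
    congr 1
    ext k : 1
    rw [ih l (by omega)]
    congr 1
    ext k'
    congr 2
    · ext i : 1
      refine Fin.cases ?_ (fun j => ?_) i
      · rfl
      · rfl
    · ext i : 1
      have : (⟨n + 1 + i, by omega⟩ : Fin (l + 1)) = Fin.succ ⟨n + i, by omega⟩ := by
        ext; simp; omega
      rw [this, Matrix.cons_val_succ]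

/-- The position of a label is the number of labels that precede it. -/
lemma orderIsoOfFin_symm_val (N : Finset ℕ) (j : N) :
    ((N.orderIsoOfFin rfl).symm j : ℕ) = (N.filter (· < j.1)).card := by
  set i := (N.orderIsoOfFin rfl).symm j with hi
  have hj : j = N.orderIsoOfFin rfl i := by simp [hi]
  have : N.filter (· < j.1) = (Finset.Iio i).map (N.orderEmbOfFin rfl).toEmbedding := by
    ext u
    simp only [Finset.mem_filter, Finset.mem_map, Finset.mem_Iio]
    constructor
    · rintro ⟨hu, huj⟩
      refine ⟨(N.orderIsoOfFin rfl).symm ⟨u, hu⟩, ?_, ?_⟩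
      · rw [hi, OrderIso.lt_iff_lt]; exact huj
      · rw [RelEmbedding.coe_toEmbedding, ← Finset.coe_orderIsoOfFin_apply]; simp
    · rintro ⟨a, ha, rfl⟩
      refine ⟨Finset.orderEmbOfFin_mem _ _ _, ?_⟩
      rw [hj, Finset.coe_orderIsoOfFin_apply]
      exact (N.orderEmbOfFin rfl).lt_iff_lt.2 ha
  rw [this, Finset.card_map, Fin.card_Iio]

variable {m : ℝ} (hm : 0 < m) (W : RegularRep σ H)

lemma phi_mul_phi {N M : Finset ℕ} (hNM : ∀ i ∈ N, ∀ j ∈ M, i < j) (f : 𝓢(Config N, ℂ))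
    (g : 𝓢(Config M, ℂ)) : phi hm W f * phi hm W g = phi hm W (tensor f g) := by
  have hdis := disjoint_of_forall_lt hNM
  have hcard := Finset.card_union_of_disjoint hdis
  refine LinearMap.ext fun Ψ => Subtype.ext ?_
  refine (fieldProduct_fieldProduct W Ψ.1 _ _ _ hcard _).trans ?_
  change _ = fieldProduct m W _ _ _
  congr 1
  ext k
  rw [fourierCheck_tensor hdis]
  congr 2
  · ext ⟨i, μ⟩
    simp only [orderedConfig, restrictConfig_apply]
    refine congrFun (congrArg k (Fin.ext ?_)) μ
    dsimp only
    rw [orderIsoOfFin_symm_val, orderIsoOfFin_symm_val]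
    congr 1
    ext u
    simp only [Finset.mem_filter, Finset.mem_union]
    have := fun h => hNM i i.2 u h
    grind
  · ext ⟨i, μ⟩
    simp only [orderedConfig, restrictConfig_apply]
    refine congrFun (congrArg k (Fin.ext ?_)) μ
    dsimp only
    rw [orderIsoOfFin_symm_val, orderIsoOfFin_symm_val]
    rw [Finset.filter_union, Finset.filter_true_of_mem fun u hu => hNM u hu i i.2,
      Finset.card_union_of_disjoint (hdis.mono_right (Finset.filter_subset _ _))]

/-- The operator `φ_f` depends on `f` only through its transform and the order of the labels. -/
lemma phi_congr {N N' : Finset ℕ} (h : N = N') (f : 𝓢(Config N, ℂ)) (g : 𝓢(Config N', ℂ))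
    (hfg : ∀ k, fourierCheck f (restrictConfig h.subset k) = fourierCheck g k) :
    phi hm W f = phi hm W g := by
  subst h
  have h : fourierCheck f = fourierCheck g := by
    ext k
    rw [← hfg k]
    congr 1
  simp only [phi, h]

end Fields

/-! ### Composition and products of quantum contractions -/

section Gamma

variable {X : Finset ℕ}

/-- A configuration with the defining properties of `C.momenta` equals it. -/
lemma Contraction.eq_momenta (C : Contraction X) {m : ℝ} {p : C.arcs → Mom3}
    {k : Config C.uncontracted} {x : Config X}
    (h1 : ∀ (c : C.arcs) (i : X), c.1.1 = i → ∀ μ, x (i, μ) = onShell m (p c) μ)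
    (h2 : ∀ (c : C.arcs) (i : X), c.1.2 = i → ∀ μ, x (i, μ) = -onShell m (p c) μ)
    (h3 : ∀ (i : X) (hi : i.1 ∈ C.uncontracted) (μ), x (i, μ) = k (⟨i, hi⟩, μ)) :
    x = C.momenta m p k := by
  ext ⟨i, μ⟩
  by_cases hi : i.1 ∈ C.uncontracted
  · rw [h3 i hi, C.momenta_uncontracted m p k i hi]
  · have : i.1 ∈ endpoints C.arcs := by
      by_contra h
      exact hi (Finset.mem_sdiff.2 ⟨i.2, h⟩)
    obtain ⟨c, hc, h | h⟩ := mem_endpoints.1 this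
    · rw [h1 ⟨c, hc⟩ i h, C.momenta_fst m p k ⟨c, hc⟩ i h]
    · rw [h2 ⟨c, hc⟩ i h, C.momenta_snd m p k ⟨c, hc⟩ i h]

/-- The arcs of `C.join D` are those of `C` and those of `D`. -/
def Contraction.joinArcs {C : Contraction X} (D : Contraction C.uncontracted) :
    C.arcs ⊕ D.arcs ≃ (C.join D).arcs :=
  Equiv.Finset.union C.arcs D.arcs (disjoint_arcs_join D)

lemma Contraction.coe_joinArcs_inl {C : Contraction X} (D : Contraction C.uncontracted)
    (a : C.arcs) : (joinArcs D (.inl a) : ℕ × ℕ) = a := rfl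

lemma Contraction.coe_joinArcs_inr {C : Contraction X} (D : Contraction C.uncontracted)
    (b : D.arcs) : (joinArcs D (.inr b) : ℕ × ℕ) = b := rfl

lemma Contraction.momenta_join (C : Contraction X) (D : Contraction C.uncontracted) (m : ℝ)
    (p : C.arcs → Mom3) (q : D.arcs → Mom3) (k : Config (C.join D).uncontracted) :
    (C.join D).momenta m (glue (joinArcs D) p q) k =
      C.momenta m p (D.momenta m q (restrictConfig (uncontracted_join D).symm.subset k)) := by
  symm
  refine Contraction.eq_momenta _ (fun c i hi μ => ?_) (fun c i hi μ => ?_) fun i hi μ => ?_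
  · obtain ⟨a | b, rfl⟩ := (joinArcs D).surjective c
    · rw [glue_inl, C.momenta_fst m _ _ a i hi]
    · have hu : i.1 ∈ C.uncontracted := hi ▸ (D.mem_and_lt b b.2).1
      rw [glue_inr, C.momenta_uncontracted m _ _ i hu, D.momenta_fst m _ _ b ⟨i, hu⟩ hi]
  · obtain ⟨a | b, rfl⟩ := (joinArcs D).surjective c
    · rw [glue_inl, C.momenta_snd m _ _ a i hi]
    · have hu : i.1 ∈ C.uncontracted := hi ▸ (D.mem_and_lt b b.2).2.1
      rw [glue_inr, C.momenta_uncontracted m _ _ i hu, D.momenta_snd m _ _ b ⟨i, hu⟩ hi]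
  · have hu := hi
    rw [uncontracted_join] at hu
    have hu' := (Finset.mem_sdiff.1 hu).1
    rw [C.momenta_uncontracted m _ _ i hu', D.momenta_uncontracted m _ _ ⟨i, hu'⟩ hu]
    rfl

/-- If `C` is quasiplanar, then the phases of `C` and of a contraction `D` of what `C` leaves over
decouple: the arcs of `C` enclose neither uncontracted labels nor endpoints of arcs of `D`, so that
they do not cross these. In particular the phase of `C` does not depend on the momenta `k'`. -/
lemma Contraction.phase_join {C : Contraction X} (hC : Quasiplanar X C.arcs)
    (D : Contraction C.uncontracted) (m : ℝ) (σ : Matrix (Fin 4) (Fin 4) ℝ)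
    (p : C.arcs → Mom3) (q : D.arcs → Mom3) (k' : Config C.uncontracted)
    (k : Config (C.join D).uncontracted) :
    (C.join D).phase m σ (glue (joinArcs D) p q) k =
      C.phase m σ p k' +
        D.phase m σ q (restrictConfig (uncontracted_join D).symm.subset k) := by
  have hno : ∀ c ∈ C.arcs, ∀ u ∈ C.uncontracted, ¬ Encloses c u := hC
  have h1 : ∀ (a : C.arcs) (b : D.arcs), ¬ Crosses a b := fun a b h =>
    hno a a.2 _ (D.mem_and_lt b b.2).1 ⟨h.1, h.2.1⟩
  have h2 : ∀ (a : C.arcs) (b : D.arcs), ¬ Crosses b a := fun a b h =>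
    hno a a.2 _ (D.mem_and_lt b b.2).2.1 ⟨h.2.1, h.2.2⟩
  have h3 : ∀ (a : C.arcs) (u : C.uncontracted), ¬ Encloses a u := fun a u =>
    hno a a.2 _ u.2
  have h4 : ∀ (a : C.arcs) (u : D.uncontracted), ¬ Encloses a u := fun a u =>
    hno a a.2 _ (Finset.mem_sdiff.1 u.2).1
  have h5 : ∀ F : (C.join D).uncontracted → ℝ, ∑ u, F u =
      ∑ u : D.uncontracted, F ⟨u, (uncontracted_join D).symm.subset u.2⟩ := fun F =>
    (Fintype.sum_equiv (Equiv.subtypeEquivRight fun u => by rw [uncontracted_join D])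
      (fun u : D.uncontracted => F ⟨u, (uncontracted_join D).symm.subset u.2⟩) F
      fun u => rfl).symm
  simp only [phase, sum_eq_sum_inl_add_sum_inr (joinArcs D), glue_inl, glue_inr, h5,
    coe_joinArcs_inl, coe_joinArcs_inr, h1, h2, h3, h4, if_false, Finset.sum_const_zero, add_zero,
    zero_add]
  rw [add_assoc]
  rfl

lemma Contraction.integrable_integrand (C : Contraction X) {m : ℝ} (hm : 0 < m)
    (σ : Matrix (Fin 4) (Fin 4) ℝ) (F : 𝓢(Config X, ℂ)) (k : Config C.uncontracted) :
    Integrable (fun p : C.arcs → Mom3 =>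
      Complex.exp (-Complex.I * C.phase m σ p k) * F (C.momenta m p k))
      (Measure.pi fun _ => massShell m) := by
  have := pi_massShell_temperate hm C.arcs
  set ν := Measure.pi fun _ : C.arcs => massShell m
  simp only [← contractionIntegrand_apply C hm]
  obtain ⟨B, _, h⟩ := schwartz_partial_bound (contractionIntegrand C hm σ F) ν.integrablePower 0
  exact (ν.integrable_pow_neg_integrablePower.const_mul B).mono'
    ((contractionIntegrand C hm σ F).continuous.comp (by fun_prop :
      Continuous fun p : C.arcs → Mom3 => (p, k))).aestronglyMeasurable
    (.of_forall fun p => by simpa using h p k)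

/-- Successive quantum contractions compose, `γ^D (γ^C f) = γ^{C ∪ D} f`, if `C` is quasiplanar. -/
lemma Contraction.fourierCheck_gamma_gamma {C : Contraction X} (hC : Quasiplanar X C.arcs)
    (D : Contraction C.uncontracted) {m : ℝ} (hm : 0 < m) (σ : Matrix (Fin 4) (Fin 4) ℝ)
    (f : 𝓢(Config X, ℂ)) (k : Config (C.join D).uncontracted) :
    fourierCheck (D.gamma hm σ (C.gamma hm σ f))
        (restrictConfig (uncontracted_join D).symm.subset k) =
      fourierCheck ((C.join D).gamma hm σ f) k := by
  have hcard : (C.join D).arcs.card = C.arcs.card + D.arcs.card :=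
    Finset.card_union_of_disjoint (disjoint_arcs_join D)
  have hint := integrable_glue (massShell m)
    (joinArcs D)
    ((C.join D).integrable_integrand hm σ (fourierCheck f) k)
  rw [fourierCheck_gamma, fourierCheck_gamma, hcard, mul_add, pow_add]
  rw [show ∫ p, Complex.exp (-Complex.I * (C.join D).phase m σ p k) *
      fourierCheck f ((C.join D).momenta m p k) ∂(Measure.pi fun _ => massShell m) = _ from
    (integral_glue (massShell m) (joinArcs D) _).trans
      (integral_prod_symm _ hint)]
  simp only [fourierCheck_gamma, momenta_join]
  rw [mul_comm ((2 * π : ℂ) ^ (8 * C.arcs.card)), mul_assoc]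
  congr 1
  rw [← integral_const_mul]
  refine integral_congr_ae (.of_forall fun q => ?_)
  dsimp only
  rw [mul_left_comm, ← integral_const_mul]
  congr 1
  refine integral_congr_ae (.of_forall fun p => ?_)
  dsimp only
  rw [C.phase_join hC D m σ p q (D.momenta m q
    (restrictConfig (uncontracted_join D).symm.subset k)), Complex.ofReal_add, mul_add,
    Complex.exp_add]
  ring

variable {N M : Finset ℕ}

lemma Contraction.uncontracted_union (hNM : Disjoint N M) (C : Contraction N)
    (D : Contraction M) :
    (C.union hNM D).uncontracted = C.uncontracted ∪ D.uncontracted := by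
  have hC : ∀ i ∈ endpoints C.arcs, i ∈ N := by
    intro i hi
    obtain ⟨c, hc, rfl | rfl⟩ := mem_endpoints.1 hi
    exacts [(C.mem_and_lt c hc).1, (C.mem_and_lt c hc).2.1]
  have hD : ∀ i ∈ endpoints D.arcs, i ∈ M := by
    intro i hi
    obtain ⟨c, hc, rfl | rfl⟩ := mem_endpoints.1 hi
    exacts [(D.mem_and_lt c hc).1, (D.mem_and_lt c hc).2.1]
  rw [Finset.disjoint_left] at hNM
  ext i
  simp only [uncontracted, union, endpoints_union, Finset.mem_sdiff, Finset.mem_union]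
  have := hC i
  have := hD i
  have := @hNM i
  tauto

lemma Contraction.uncontracted_subset_union_left (hNM : Disjoint N M) (C : Contraction N)
    (D : Contraction M) : C.uncontracted ⊆ (C.union hNM D).uncontracted := by
  rw [uncontracted_union]
  exact Finset.subset_union_left

lemma Contraction.uncontracted_subset_union_right (hNM : Disjoint N M) (C : Contraction N)
    (D : Contraction M) : D.uncontracted ⊆ (C.union hNM D).uncontracted := by
  rw [uncontracted_union]
  exact Finset.subset_union_right

/-- The arcs of `C.union hNM D` are those of `C` and those of `D`. -/
def Contraction.unionArcs (hNM : Disjoint N M) (C : Contraction N) (D : Contraction M) :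
    C.arcs ⊕ D.arcs ≃ (C.union hNM D).arcs :=
  Equiv.Finset.union C.arcs D.arcs (C.disjoint_arcs_union hNM D)

lemma Contraction.coe_unionArcs_inl (hNM : Disjoint N M) (C : Contraction N) (D : Contraction M)
    (a : C.arcs) : (unionArcs hNM C D (.inl a) : ℕ × ℕ) = a := rfl

lemma Contraction.coe_unionArcs_inr (hNM : Disjoint N M) (C : Contraction N) (D : Contraction M)
    (b : D.arcs) : (unionArcs hNM C D (.inr b) : ℕ × ℕ) = b := rfl

lemma Contraction.momenta_union_left (hNM : Disjoint N M) (C : Contraction N) (D : Contraction M)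
    (m : ℝ) (p : C.arcs → Mom3) (q : D.arcs → Mom3) (k : Config (C.union hNM D).uncontracted) :
    restrictConfig Finset.subset_union_left ((C.union hNM D).momenta m
      (glue (unionArcs hNM C D) p q) k) =
    C.momenta m p (restrictConfig (C.uncontracted_subset_union_left hNM D) k) := by
  refine Contraction.eq_momenta _ (fun c i hi μ => ?_) (fun c i hi μ => ?_) fun i hi μ => ?_
  · rw [restrictConfig_apply, (C.union hNM D).momenta_fst m _ _
      (unionArcs hNM C D (.inl c)) ⟨i, _⟩ hi, glue_inl]
  · rw [restrictConfig_apply, (C.union hNM D).momenta_snd m _ _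
      (unionArcs hNM C D (.inl c)) ⟨i, _⟩ hi, glue_inl]
  · rw [restrictConfig_apply, (C.union hNM D).momenta_uncontracted m _ _ _
      (C.uncontracted_subset_union_left hNM D hi), restrictConfig_apply]

lemma Contraction.momenta_union_right (hNM : Disjoint N M) (C : Contraction N) (D : Contraction M)
    (m : ℝ) (p : C.arcs → Mom3) (q : D.arcs → Mom3) (k : Config (C.union hNM D).uncontracted) :
    restrictConfig Finset.subset_union_right ((C.union hNM D).momenta m
      (glue (unionArcs hNM C D) p q) k) =
    D.momenta m q (restrictConfig (C.uncontracted_subset_union_right hNM D) k) := by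
  refine Contraction.eq_momenta _ (fun c i hi μ => ?_) (fun c i hi μ => ?_) fun i hi μ => ?_
  · rw [restrictConfig_apply, (C.union hNM D).momenta_fst m _ _
      (unionArcs hNM C D (.inr c)) ⟨i, _⟩ hi, glue_inr]
  · rw [restrictConfig_apply, (C.union hNM D).momenta_snd m _ _
      (unionArcs hNM C D (.inr c)) ⟨i, _⟩ hi, glue_inr]
  · rw [restrictConfig_apply, (C.union hNM D).momenta_uncontracted m _ _ _
      (C.uncontracted_subset_union_right hNM D hi), restrictConfig_apply]

/-- Arcs in `N` and in `M` neither cross each other nor enclose labels of the other set. -/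
lemma Contraction.phase_union (hNM : ∀ i ∈ N, ∀ j ∈ M, i < j) (C : Contraction N)
    (D : Contraction M) (m : ℝ) (σ : Matrix (Fin 4) (Fin 4) ℝ) (p : C.arcs → Mom3)
    (q : D.arcs → Mom3) (k : Config (C.union (disjoint_of_forall_lt hNM) D).uncontracted) :
    (C.union (disjoint_of_forall_lt hNM) D).phase m σ
        (glue (unionArcs (disjoint_of_forall_lt hNM) C D) p q) k =
      C.phase m σ p (restrictConfig (C.uncontracted_subset_union_left _ D) k) +
        D.phase m σ q (restrictConfig (C.uncontracted_subset_union_right _ D) k) := by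
  have hdis := disjoint_of_forall_lt hNM
  have hCN : ∀ u ∈ C.uncontracted, u ∈ N := fun u hu => (Finset.mem_sdiff.1 hu).1
  have hDM : ∀ u ∈ D.uncontracted, u ∈ M := fun u hu => (Finset.mem_sdiff.1 hu).1
  have h1 : ∀ (a : C.arcs) (b : D.arcs), ¬ Crosses a b := fun a b h =>
    absurd (hNM _ (C.mem_and_lt a a.2).2.1 _ (D.mem_and_lt b b.2).1) (not_lt.2 h.2.1.le)
  have h2 : ∀ (a : C.arcs) (b : D.arcs), ¬ Crosses b a := fun a b h =>
    absurd (hNM _ (C.mem_and_lt a a.2).1 _ (D.mem_and_lt b b.2).1) (not_lt.2 h.1.le)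
  have h3 : ∀ (a : C.arcs) (u : D.uncontracted), ¬ Encloses a u := fun a u h =>
    absurd (hNM _ (C.mem_and_lt a a.2).2.1 _ (hDM u u.2)) (not_lt.2 h.2.le)
  have h4 : ∀ (b : D.arcs) (u : C.uncontracted), ¬ Encloses b u := fun b u h =>
    absurd (hNM _ (hCN u u.2) _ (D.mem_and_lt b b.2).1) (not_lt.2 h.1.le)
  have hunc : Disjoint C.uncontracted D.uncontracted :=
    Finset.disjoint_of_subset_left hCN (Finset.disjoint_of_subset_right hDM hdis)
  have h5 : ∀ F : (C.union hdis D).uncontracted → ℝ, ∑ u, F u =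
      ∑ u : C.uncontracted, F ⟨u, C.uncontracted_subset_union_left hdis D u.2⟩ +
      ∑ u : D.uncontracted, F ⟨u, C.uncontracted_subset_union_right hdis D u.2⟩ := by
    intro F
    rw [← Fintype.sum_equiv (Equiv.subtypeEquivRight fun u => by rw [uncontracted_union hdis C D])
      (fun u : ↥(C.uncontracted ∪ D.uncontracted) =>
        F ⟨u, (uncontracted_union hdis C D).symm.subset u.2⟩) F fun u => rfl,
      sum_eq_sum_inl_add_sum_inr (Equiv.Finset.union _ _ hunc)]
    rfl
  simp only [phase, sum_eq_sum_inl_add_sum_inr (unionArcs hdis C D), glue_inl, glue_inr, h5,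
    coe_unionArcs_inl, coe_unionArcs_inr, h1, h2, h3, h4, if_false, Finset.sum_const_zero,
    add_zero, zero_add]
  rw [add_add_add_comm]
  rfl

/-- Quantum contractions are compatible with tensor products of test functions,
`γ^C f ⊗ γ^D g = γ^{C ∪ D} (f ⊗ g)`. -/
lemma Contraction.fourierCheck_gamma_union (hNM : ∀ i ∈ N, ∀ j ∈ M, i < j) (C : Contraction N)
    (D : Contraction M) {m : ℝ} (hm : 0 < m) (σ : Matrix (Fin 4) (Fin 4) ℝ)
    (f : 𝓢(Config N, ℂ)) (g : 𝓢(Config M, ℂ))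
    (k : Config (C.union (disjoint_of_forall_lt hNM) D).uncontracted) :
    fourierCheck (tensor (C.gamma hm σ f) (D.gamma hm σ g))
        (restrictConfig (uncontracted_union (disjoint_of_forall_lt hNM) C D).symm.subset k) =
      fourierCheck ((C.union (disjoint_of_forall_lt hNM) D).gamma hm σ (tensor f g)) k := by
  have hdis := disjoint_of_forall_lt hNM
  have hunc : Disjoint C.uncontracted D.uncontracted :=
    Finset.disjoint_of_subset_left Finset.sdiff_subset
      (Finset.disjoint_of_subset_right Finset.sdiff_subset hdis)
  have hcard : (C.union hdis D).arcs.card = C.arcs.card + D.arcs.card :=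
    Finset.card_union_of_disjoint (C.disjoint_arcs_union hdis D)
  rw [fourierCheck_tensor hunc, fourierCheck_gamma, fourierCheck_gamma, fourierCheck_gamma, hcard,
    mul_add, pow_add, mul_mul_mul_comm, ← integral_prod_mul]
  congr 1
  refine Eq.trans ?_ (integral_glue (massShell m) (unionArcs hdis C D) _).symm
  congr 1
  ext z
  rw [phase_union hNM, fourierCheck_tensor hdis, momenta_union_left, momenta_union_right,
    Complex.ofReal_add, mul_add, Complex.exp_add, mul_mul_mul_comm]
  rfl

end Gamma

end QPWick

theorem theorem1 {m ℓ : ℝ} (hm : 0 < m) (hℓ : 0 < ℓ)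
    {σ : Matrix (Fin 4) (Fin 4) ℝ} (hσ : σ ∈ quantumSpectrum ℓ)
    {H : Type*} [NormedAddCommGroup H] [InnerProductSpace ℂ H] [CompleteSpace H]
    (W : RegularRep σ H)
    (N M : Finset ℕ) (hNM : ∀ i ∈ N, ∀ j ∈ M, i < j)
    (f : 𝓢(Config N, ℂ)) (g : 𝓢(Config M, ℂ)) :
    qpWick hm W f * qpWick hm W g =
      ∑ C ∈ connectingContractions N M, qpWick hm W (C.gamma hm σ (tensor f g)) := by
  have h := sum_connecting_join hNM fun C => phi hm W (C.gamma hm σ (tensor f g))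
  have hR : ∀ C ∈ connectingContractions N M, qpWick hm W (C.gamma hm σ (tensor f g)) =
      ∑ D ∈ qpContractions C.uncontracted, (-1 : ℂ) ^ (components D.arcs).card •
        phi hm W ((C.join D).gamma hm σ (tensor f g)) := by
    intro C hC
    refine Finset.sum_congr rfl fun D _ => congrArg _ ?_
    exact phi_congr hm W (Contraction.uncontracted_join D).symm _ _
      (Contraction.fourierCheck_gamma_gamma (mem_connectingContractions.1 hC).1 D hm σ _)
  rw [Finset.sum_congr rfl hR, h, qpWick, qpWick, Finset.sum_mul_sum]
  refine Finset.sum_congr rfl fun C _ => Finset.sum_congr rfl fun D _ => ?_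
  rw [smul_mul_smul_comm, ← pow_add, phi_mul_phi hm W (N := C.uncontracted) (M := D.uncontracted)
    fun i hi j hj => hNM i (Finset.mem_sdiff.1 hi).1 j (Finset.mem_sdiff.1 hj).1]
  exact congrArg _ (phi_congr hm W
    (Contraction.uncontracted_union (disjoint_of_forall_lt hNM) C D).symm _ _
    (Contraction.fourierCheck_gamma_union hNM C D hm σ f g))
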